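/- Let $n\ge 1$ and let $B=B(c,R)\subset\mathbb R^n$ ($R>0$) be an open Euclidean ball. Let $\phi$ be a convex function in $B$, continuous on the closed ball $\overline B$ and vanishing on the boundary $\partial B$. Let $\hat\phi$ be its Schwarz symmetrization, i.e. the radial function on $B(0,R)$, increasing in $|x|$ and equidistributed with $\phi$, given by $$\hat\phi(x)=\inf\{t\in\mathbb R:\ |\{y\in B:\phi(y)<t\}|>|B(0,|x|)|\},\qquad |x|<R,$$ where $|\cdot|$ of a set is Lebesgue measure. For a function $u\le 0$ on an open ball $\Omega$ write $$\mathcal E_\Omega(u)=\int_\Omega(-u)\,MA(u)\in[0,\infty],$$ where $MA(u)$ is the Monge–Ampère measure (in the sense of Alexandrov) of $u$ on $\Omega$: for Borel sets $A$, $MA(u)(A)$ is the Lebesgue measure of the set of all $p\in\mathbb R^n$ such that, for some $x\in A\cap\Omega$, $u(y)\ge u(x)+\langle p,y-x\rangle$ for all $y\in\Omega$ (so that $MA(u)=\det(u_{jk})\,dx$ for convex $u$ of class $C^2$). Then $$\mathcal E_{B(0,R)}(\hat\phi)\le\mathcal E_{B}(\phi).$$ -/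

import Mathlib

open MeasureTheory Set Metric

namespace SchwarzMA

/-- The space `ℝⁿ` with its Euclidean norm and Lebesgue measure `volume`. -/
abbrev E (n : ℕ) : Type := EuclideanSpace ℝ (Fin n)

/-- The Schwarz symmetrization of a function `φ` on a domain `Ω ⊆ ℝⁿ`, a radial function on the
ball centred at the origin that has the same volume as `Ω`:
`φ̂(x) = inf {t : |{y ∈ Ω : φ(y) < t}| > |B(0, |x|)|}`, the generalized inverse of
`σ(t) = |{φ < t}|` evaluated at the volume of the ball of radius `|x|`. -/
noncomputable def schwarz {n : ℕ} (Ω : Set (E n)) (φ : E n → ℝ) (x : E n) : ℝ :=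
  sInf {t : ℝ | volume (ball (0 : E n) ‖x‖) < volume {y ∈ Ω | φ y < t}}

/-- The subdifferential at `x` of a function `φ` on `Ω`. -/
def subdifferential {n : ℕ} (Ω : Set (E n)) (φ : E n → ℝ) (x : E n) : Set (E n) :=
  {p | ∀ y ∈ Ω, φ x + inner ℝ p (y - x) ≤ φ y}

/-- The gradient image `∂φ(A) = ⋃ {∂φ(x) : x ∈ A ∩ Ω}`. -/
def gradImage {n : ℕ} (Ω : Set (E n)) (φ : E n → ℝ) (A : Set (E n)) : Set (E n) :=
  ⋃ x ∈ A ∩ Ω, subdifferential Ω φ x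

/-- The Monge-Ampère measure in the sense of Alexandrov of a function `φ` on `Ω`:
`MA(φ)(A) = |∂φ(A ∩ Ω)|` for Borel sets `A`. It is introduced for every `φ` as the least Borel
measure `μ` with `|∂φ(A ∩ Ω)| ≤ μ(A)` for all Borel sets `A`; `mongeAmpere_apply` below shows that
equality holds for the functions that matter. -/
noncomputable def mongeAmpere {n : ℕ} (Ω : Set (E n)) (φ : E n → ℝ) : Measure (E n) :=
  sInf {μ | ∀ A, MeasurableSet A → volume (gradImage Ω φ A) ≤ μ A}

/-- The Monge-Ampère energy `∫_Ω (-φ) MA(φ)`, with values in `[0, ∞]`, of a function `φ ≤ 0`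
on `Ω`. -/
noncomputable def energy {n : ℕ} (Ω : Set (E n)) (φ : E n → ℝ) : ENNReal :=
  ∫⁻ x in Ω, ENNReal.ofReal (-φ x) ∂(mongeAmpere Ω φ)

/-! ### The definitions give the usual objects -/

theorem gradImage_iUnion {n : ℕ} (Ω : Set (E n)) (φ : E n → ℝ) (A : ℕ → Set (E n)) :
    gradImage Ω φ (⋃ i, A i) = ⋃ i, gradImage Ω φ (A i) := by
  ext p
  simp only [gradImage, mem_iUnion, mem_inter_iff]
  constructor
  · rintro ⟨x, ⟨⟨i, hi⟩, hx⟩, hp⟩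
    exact ⟨i, x, ⟨hi, hx⟩, hp⟩
  · rintro ⟨i, x, ⟨hi, hx⟩, hp⟩
    exact ⟨x, ⟨⟨i, hi⟩, hx⟩, hp⟩

/-- Almost no vector is a subgradient at two different points (via the Legendre transform). -/
theorem volume_overlap {n : ℕ} {Ω : Set (E n)} (hb : Bornology.IsBounded Ω) (φ : E n → ℝ) :
    volume {p : E n | ∃ x ∈ Ω, ∃ x' ∈ Ω, x ≠ x' ∧ p ∈ subdifferential Ω φ x ∧
      p ∈ subdifferential Ω φ x'} = 0 := by
  rcases eq_empty_or_nonempty {p : E n | ∃ x ∈ Ω, ∃ x' ∈ Ω, x ≠ x' ∧ p ∈ subdifferential Ω φ x ∧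
      p ∈ subdifferential Ω φ x'} with h | ⟨p₀, x₀, hx₀, -, -, -, hp₀, -⟩
  · rw [h, measure_empty]
  obtain ⟨M, hM⟩ := hb.exists_norm_le
  have hM0 : 0 ≤ M := (norm_nonneg x₀).trans (hM x₀ hx₀)
  let f : E n → ℝ := fun p => ⨆ x : Ω, (inner ℝ p (x : E n) - φ x)
  have hbdd : ∀ p : E n, BddAbove (range fun x : Ω => inner ℝ p (x : E n) - φ x) := by
    intro p
    refine ⟨‖p‖ * M - φ x₀ + ‖p₀‖ * (M + M), ?_⟩
    rintro _ ⟨⟨x, hx⟩, rfl⟩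
    have h1 := hp₀ x hx
    have h2 : inner ℝ p x ≤ ‖p‖ * M :=
      (real_inner_le_norm p x).trans (by gcongr; exact hM x hx)
    have h3 : -(‖p₀‖ * (M + M)) ≤ inner ℝ p₀ (x - x₀) := by
      have h4 := neg_le_of_abs_le (abs_real_inner_le_norm p₀ (x - x₀))
      have h5 : ‖x - x₀‖ ≤ M + M := (norm_sub_le _ _).trans (add_le_add (hM x hx) (hM x₀ hx₀))
      have h6 : ‖p₀‖ * ‖x - x₀‖ ≤ ‖p₀‖ * (M + M) := by gcongr
      linarith
    simp only
    linarith
  have : Nonempty Ω := ⟨⟨x₀, hx₀⟩⟩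
  have hlip : LipschitzWith ⟨M, hM0⟩ f := by
    refine LipschitzWith.of_le_add_mul _ fun p q => ciSup_le fun x => ?_
    have h1 := le_ciSup (hbdd q) x
    have h2 : inner ℝ (p - q) (x : E n) ≤ ‖p - q‖ * M :=
      (real_inner_le_norm _ _).trans (by gcongr; exact hM x x.2)
    rw [inner_sub_left] at h2
    rw [dist_eq_norm]
    change _ ≤ f q + M * ‖p - q‖
    change _ ≤ f q at h1
    linarith
  have hae := hlip.ae_differentiableAt (μ := (volume : Measure (E n)))
  refine measure_mono_null ?_ (ae_iff.1 hae)
  rintro p ⟨x, hx, x', hx', hne, hp, hp'⟩ hd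
  have key : ∀ z ∈ Ω, p ∈ subdifferential Ω φ z → fderiv ℝ f p = innerSL ℝ z := by
    intro z hz hpz
    have hmin : IsLocalMin (fun q => f q - innerSL ℝ z q) p := by
      refine Filter.Eventually.of_forall fun q => ?_
      have h1 := le_ciSup (hbdd q) ⟨z, hz⟩
      change _ ≤ f q at h1
      have h2 : f p ≤ inner ℝ p z - φ z := ciSup_le fun y => by
        have := hpz y y.2
        rw [inner_sub_right] at this
        linarith
      simp only [innerSL_apply_apply]
      rw [real_inner_comm p z, real_inner_comm q z]
      simp only at h1
      linarith
    have h3 := hmin.fderiv_eq_zero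
    have h4 : HasFDerivAt (fun q => f q - innerSL ℝ z q) (fderiv ℝ f p - innerSL ℝ z) p :=
      hd.hasFDerivAt.sub (innerSL ℝ z).hasFDerivAt
    rw [h4.fderiv] at h3
    exact sub_eq_zero.1 h3
  have heq : innerSL ℝ x = innerSL ℝ x' := (key x hx hp).symm.trans (key x' hx' hp')
  refine hne (ext_inner_right ℝ fun v => ?_)
  simpa using congrArg (fun L => L v) heq

theorem aedisjoint_gradImage {n : ℕ} {Ω : Set (E n)} (hb : Bornology.IsBounded Ω) (φ : E n → ℝ)
    {A B : Set (E n)} (h : Disjoint A B) :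
    AEDisjoint volume (gradImage Ω φ A) (gradImage Ω φ B) := by
  refine measure_mono_null ?_ (volume_overlap hb φ)
  rintro p ⟨hA, hB⟩
  simp only [gradImage, mem_iUnion, mem_inter_iff] at hA hB
  obtain ⟨x, ⟨hxA, hx⟩, hpx⟩ := hA
  obtain ⟨y, ⟨hyB, hy⟩, hpy⟩ := hB
  exact ⟨x, hx, y, hy, fun e => disjoint_left.1 h hxA (e ▸ hyB), hpx, hpy⟩

theorem isClosed_gradImage {n : ℕ} {Ω : Set (E n)} {φ : E n → ℝ} (hφ : ContinuousOn φ Ω)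
    {K : Set (E n)} (hK : IsCompact K) (hKΩ : K ⊆ Ω) : IsClosed (gradImage Ω φ K) := by
  refine IsSeqClosed.isClosed fun u p hu hup => ?_
  simp only [gradImage, mem_iUnion, mem_inter_iff] at hu
  choose x hx hux using hu
  obtain ⟨a, haK, g, hg, hxa⟩ := hK.tendsto_subseq fun k => (hx k).1
  simp only [gradImage, mem_iUnion, mem_inter_iff]
  refine ⟨a, ⟨haK, hKΩ haK⟩, fun y hy => ?_⟩
  have h1 : Filter.Tendsto (fun k => φ (x (g k))) Filter.atTop (nhds (φ a)) :=
    (hφ a (hKΩ haK)).tendsto.comp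
      (tendsto_nhdsWithin_iff.2 ⟨hxa, Filter.Eventually.of_forall fun k => (hx (g k)).2⟩)
  have h2 : Filter.Tendsto (fun k => (inner ℝ (u (g k)) (y - x (g k)) : ℝ)) Filter.atTop
      (nhds (inner ℝ p (y - a))) :=
    (hup.comp hg.tendsto_atTop).inner (tendsto_const_nhds.sub hxa)
  exact le_of_tendsto' (h1.add h2) fun k => hux (g k) y hy

theorem nullMeasurableSet_gradImage {n : ℕ} {Ω : Set (E n)} (hΩ : IsOpen Ω)
    (hb : Bornology.IsBounded Ω) {φ : E n → ℝ} (hφ : ContinuousOn φ Ω) {A : Set (E n)}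
    (hA : MeasurableSet A) : NullMeasurableSet (gradImage Ω φ A) := by
  have hopen : ∀ U : Set (E n), IsOpen U → NullMeasurableSet (gradImage Ω φ U) := by
    intro U hU
    obtain ⟨F, hF, -, hFU, -⟩ := (hU.inter hΩ).exists_iUnion_isClosed
    have h1 : gradImage Ω φ U = ⋃ i, gradImage Ω φ (F i) := by
      rw [← gradImage_iUnion, hFU]
      simp [gradImage, inter_assoc]
    rw [h1]
    have hFΩ : ∀ i, F i ⊆ Ω := fun i =>
      (subset_iUnion F i).trans (hFU.le.trans inter_subset_right)
    exact NullMeasurableSet.iUnion fun i => (isClosed_gradImage hφ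
      (isCompact_of_isClosed_isBounded (hF i) (hb.subset (hFΩ i))) (hFΩ i)).nullMeasurableSet
  induction A, hA using MeasurableSet.induction_on_open with
  | isOpen U hU => exact hopen U hU
  | compl t ht ih =>
    have huniv := (hopen univ isOpen_univ).diff ih
    have hnull : volume (gradImage Ω φ t ∩ gradImage Ω φ tᶜ) = 0 :=
      aedisjoint_gradImage hb φ disjoint_compl_right
    have h2 : gradImage Ω φ tᶜ = (gradImage Ω φ univ \ gradImage Ω φ t) ∪
        (gradImage Ω φ t ∩ gradImage Ω φ tᶜ) := by
      have h3 : gradImage Ω φ univ = gradImage Ω φ t ∪ gradImage Ω φ tᶜ := by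
        simp only [gradImage]
        rw [← biUnion_union, ← union_inter_distrib_right, union_compl_self]
      rw [h3]
      ext p
      simp only [mem_union, mem_sdiff, mem_inter_iff]
      tauto
    rw [h2]
    exact huniv.union (NullMeasurableSet.of_null hnull)
  | iUnion f _ _ ih =>
    rw [gradImage_iUnion]
    exact NullMeasurableSet.iUnion ih

/-- `MA(φ)(A) = |∂φ(A ∩ Ω)|` for every Borel set `A`, whenever `Ω` is open and bounded and `φ` is
continuous on `Ω`, in particular whenever `φ` is convex there. -/
theorem mongeAmpere_apply {n : ℕ} {Ω : Set (E n)} (hΩ : IsOpen Ω) (hb : Bornology.IsBounded Ω)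
    {φ : E n → ℝ} (hφ : ContinuousOn φ Ω) {A : Set (E n)} (hA : MeasurableSet A) :
    mongeAmpere Ω φ A = volume (gradImage Ω φ A) := by
  let ν : Measure (E n) := Measure.ofMeasurable (fun A _ => volume (gradImage Ω φ A))
    (by simp [gradImage]) (by
      intro f hf hd
      rw [gradImage_iUnion]
      exact measure_iUnion₀ (fun i j hij => aedisjoint_gradImage hb φ (hd hij))
        fun i => nullMeasurableSet_gradImage hΩ hb hφ (hf i))
  have hν : ∀ A, MeasurableSet A → ν A = volume (gradImage Ω φ A) :=
    fun A hA => Measure.ofMeasurable_apply A hA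
  have h : mongeAmpere Ω φ = ν :=
    le_antisymm (sInf_le fun A hA => (hν A hA).ge)
      (le_sInf fun μ hμ => Measure.le_iff.2 fun A hA => (hν A hA).le.trans (hμ A hA))
  rw [h, hν A hA]

/-- The symmetrization is an increasing function of `|x|` for `|x| < R`, and it is equidistributed
with `φ`; here `Ω` has the volume of the ball of radius `R` about the origin, and `φ` is bounded
on `Ω`. -/
theorem schwarz_spec {n : ℕ} (hn : 1 ≤ n) {Ω : Set (E n)} {φ : E n → ℝ} {R m : ℝ}
    (hR : volume Ω = volume (ball (0 : E n) R)) (hm : ∀ y ∈ Ω, |φ y| ≤ m) :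
    (∀ x y : E n, ‖x‖ ≤ ‖y‖ → ‖y‖ < R → schwarz Ω φ x ≤ schwarz Ω φ y) ∧
    ∀ t : ℝ, volume {x ∈ ball (0 : E n) R | schwarz Ω φ x < t} = volume {y ∈ Ω | φ y < t} := by
  have hn0 : n ≠ 0 := by omega
  have : Nonempty (Fin n) := ⟨⟨0, hn⟩⟩
  set v := volume (ball (0 : E n) 1) with hv
  have hv0 : v ≠ 0 := (measure_ball_pos volume _ one_pos).ne'
  have hvt : v ≠ ⊤ := measure_ball_lt_top.ne
  have hvol : ∀ r : ℝ, 0 ≤ r → volume (ball (0 : E n) r) = ENNReal.ofReal (r ^ n) * v := by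
    intro r hr
    have := Measure.addHaar_ball (volume : Measure (E n)) 0 hr
    simpa using this
  have hlt : ∀ r s : ℝ, 0 ≤ r → 0 ≤ s →
      (volume (ball (0 : E n) r) < volume (ball (0 : E n) s) ↔ r < s) := by
    intro r s hr hs
    rw [hvol r hr, hvol s hs, ENNReal.mul_lt_mul_iff_left hv0 hvt,
      ENNReal.ofReal_lt_ofReal_iff_of_nonneg (pow_nonneg hr n), pow_lt_pow_iff_left₀ hr hs hn0]
  have hne : ∀ x : E n, ‖x‖ < R →
      {t : ℝ | volume (ball (0 : E n) ‖x‖) < volume {y ∈ Ω | φ y < t}}.Nonempty := by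
    intro x hx
    refine ⟨m + 1, ?_⟩
    have h1 : {y ∈ Ω | φ y < m + 1} = Ω := by
      ext y
      simp only [mem_ofPred_eq, and_iff_left_iff_imp]
      intro hy
      linarith [le_abs_self (φ y), hm y hy]
    simp only [mem_ofPred_eq]
    rw [h1, hR, hlt _ _ (norm_nonneg x) ((norm_nonneg x).trans hx.le)]
    exact hx
  have hbb : ∀ x : E n,
      BddBelow {t : ℝ | volume (ball (0 : E n) ‖x‖) < volume {y ∈ Ω | φ y < t}} := by
    intro x
    refine ⟨-m, fun t ht => ?_⟩
    by_contra hlt'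
    have h1 : {y ∈ Ω | φ y < t} = ∅ := by
      ext y
      simp only [mem_ofPred_eq, mem_empty_iff_false, iff_false, not_and, not_lt]
      intro hy
      linarith [neg_abs_le (φ y), hm y hy]
    simp [h1] at ht
  refine ⟨fun x y hxy hy => ?_, fun t => ?_⟩
  · refine csInf_le_csInf (hbb x) (hne y hy) fun t ht => ?_
    exact (measure_mono (ball_subset_ball hxy)).trans_lt ht
  · have hstep : ∀ x : E n, ‖x‖ < R → (schwarz Ω φ x < t ↔
        volume (ball (0 : E n) ‖x‖) < volume {y ∈ Ω | φ y < t}) := by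
      intro x hx
      rw [schwarz, csInf_lt_iff (hbb x) (hne x hx)]
      constructor
      · rintro ⟨s, hs, hst⟩
        exact lt_of_lt_of_le hs (measure_mono fun y hy => ⟨hy.1, hy.2.trans hst⟩)
      · intro h
        have hU : {y ∈ Ω | φ y < t} = ⋃ k : ℕ, {y ∈ Ω | φ y < t - 1 / ((k : ℝ) + 1)} := by
          ext y
          simp only [mem_ofPred_eq, mem_iUnion]
          constructor
          · rintro ⟨hy, hyt⟩
            obtain ⟨k, hk⟩ := exists_nat_one_div_lt (sub_pos.2 hyt)
            exact ⟨k, hy, by linarith⟩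
          · rintro ⟨k, hy, hyt⟩
            have : (0 : ℝ) < 1 / ((k : ℝ) + 1) := by positivity
            exact ⟨hy, by linarith⟩
        have hmono : Monotone fun k : ℕ => {y ∈ Ω | φ y < t - 1 / ((k : ℝ) + 1)} := by
          intro k l hkl y hy
          have := Nat.one_div_le_one_div (α := ℝ) hkl
          exact ⟨hy.1, hy.2.trans_le (by linarith)⟩
        rw [hU, hmono.measure_iUnion, lt_iSup_iff] at h
        obtain ⟨k, hk⟩ := h
        have : (0 : ℝ) < 1 / ((k : ℝ) + 1) := by positivity
        exact ⟨_, hk, by linarith⟩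
    have hle : volume {y ∈ Ω | φ y < t} ≤ volume (ball (0 : E n) R) :=
      (measure_mono fun y hy => hy.1).trans hR.le
    have hfin : volume {y ∈ Ω | φ y < t} ≠ ⊤ := (hle.trans_lt measure_ball_lt_top).ne
    obtain ⟨ρ, hρ0, hρ⟩ : ∃ ρ : ℝ, 0 ≤ ρ ∧
        volume {y ∈ Ω | φ y < t} = volume (ball (0 : E n) ρ) := by
      refine ⟨((volume {y ∈ Ω | φ y < t} / v).toReal) ^ ((n : ℝ)⁻¹), by positivity, ?_⟩
      rw [hvol _ (by positivity), Real.rpow_inv_natCast_pow ENNReal.toReal_nonneg hn0,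
        ENNReal.ofReal_toReal (ENNReal.div_ne_top hfin hv0), ENNReal.div_mul_cancel hv0 hvt]
    rw [hρ]
    congr 1
    ext x
    simp only [mem_ofPred_eq, mem_ball_zero_iff]
    constructor
    · rintro ⟨hx, hxt⟩
      rw [hstep x hx, hρ] at hxt
      exact (hlt _ _ (norm_nonneg x) hρ0).1 hxt
    · intro hx
      have h1 : volume (ball (0 : E n) ‖x‖) < volume (ball (0 : E n) ρ) :=
        (hlt _ _ (norm_nonneg x) hρ0).2 hx
      have hxR : ‖x‖ < R := by
        by_contra hcon
        exact absurd (h1.trans_le (hρ ▸ hle)) (not_lt.2 (measure_mono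
          (ball_subset_ball (not_lt.1 hcon))))
      exact ⟨hxR, (hstep x hxR).2 (hρ ▸ h1)⟩

end SchwarzMA

/-! The two energies are integrals of Legendre transforms, and these are compared by Urysohn's
inequality.

For a function `φ` on the ball `B(c, R)` let `F(p) = sup_y (⟨p, y - c⟩ - φ(y)) - R ‖p‖`, the excess
of the Legendre transform over the support function of the ball. Formally, the change of variables
`p = ∇φ(x)` turns the energy into the integral of `F(p) - ⟨p, ∇F(p)⟩`, and an integration by parts
gives `E(φ) = (n + 1) ∫ F`. No derivative is needed for this: `μ F(p / μ) - F(p) ≥ (μ - 1)(-φ(x))`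
for every `μ > 0` when `p` is a subgradient at `x`, while the integral of `μ F(p / μ)` is `μ^(n+1)`
times that of `F`. Integrating, and letting `μ` tend to `1` from either side, bounds the energy
from above (`energy_le_lintegral_legendreExcess`) and from below
(`lintegral_legendreExcess_le_energy`). The lower bound uses that `φ` vanishes on the sphere.

It remains to compare `∫ F` with the integral of the excess of the symmetrization. The Legendre
transform of `φ` is the supremum over `t` of the support functions of the sublevel sets `{φ < t}`
minus `t`. Averaging it over the sphere `‖p‖ = s` replaces the support function by `s` times half
the mean width, and Urysohn's inequality (`mul_le_rotationAverage`) bounds this below by `s` times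
the radius of the ball with the volume of `{φ < t}`. That radius gives the Legendre transform of
the symmetrization, so the rotation average of `F` dominates the excess of the symmetrization
pointwise (`legendreExcess_schwarz_le`), and averaging does not change `∫ F`.

Urysohn's inequality follows from the Brunn–Minkowski inequality, by which the functions on a
sphere whose Wulff shape has at least a given volume form a closed convex set: the average over the
orthogonal group of the rotated copies of a support function is a constant in that set. The
Brunn–Minkowski inequality comes from the Prékopa–Leindler inequality, by induction on the
dimension.
-/

namespace SchwarzMA

/-! ### The Brunn–Minkowski inequality -/

/-- The Brunn–Minkowski inequality on the line, for a set `C` that contains `a A + b B`. Translates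
of `a K` and of `b L` that meet in a single point fit into `C`, for compact `K ⊆ A` and `L ⊆ B`. -/
theorem add_volume_le_of_combo_subset {A B C : Set ℝ} (hA : MeasurableSet A)
    (hB : MeasurableSet B) (hA0 : A.Nonempty) (hB0 : B.Nonempty) {a b : ℝ} (ha : 0 < a)
    (hb : 0 < b) (hC : ∀ x ∈ A, ∀ y ∈ B, a * x + b * y ∈ C) :
    ENNReal.ofReal a * volume A + ENNReal.ofReal b * volume B ≤ volume C := by
  have key : ∀ K L : Set ℝ, IsCompact K → IsCompact L → K ⊆ A → L ⊆ B → K.Nonempty →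
      L.Nonempty → ENNReal.ofReal a * volume K + ENNReal.ofReal b * volume L ≤ volume C := by
    intro K L hK hL hKA hLB hK0 hL0
    obtain ⟨k, hk, hkmax⟩ := hK.exists_isGreatest hK0
    obtain ⟨l, hl, hlmin⟩ := hL.exists_isLeast hL0
    have e1 : volume ((fun x => a * x + b * l) '' K) = ENNReal.ofReal a * volume K := by
      have h := Measure.addHaar_image_homothety (volume : Measure ℝ) 0 a K
      have : (fun x => a * x + b * l) '' K =
          (fun z => z + b * l) '' (AffineMap.homothety (0 : ℝ) a '' K) := by
        rw [image_image]; simp [AffineMap.homothety_apply]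
      rw [this, image_add_right, measure_preimage_add_right, h]
      simp [abs_of_pos ha]
    have e2 : volume ((fun y => a * k + b * y) '' L) = ENNReal.ofReal b * volume L := by
      have h := Measure.addHaar_image_homothety (volume : Measure ℝ) 0 b L
      have : (fun y => a * k + b * y) '' L =
          (fun z => a * k + z) '' (AffineMap.homothety (0 : ℝ) b '' L) := by
        rw [image_image]; simp [AffineMap.homothety_apply]
      rw [this, image_add_left, measure_preimage_add, h]
      simp [abs_of_pos hb]
    rw [← e1, ← e2, ← measure_union₀]
    · refine measure_mono (union_subset ?_ ?_)
      · rintro _ ⟨x, hx, rfl⟩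
        exact hC x (hKA hx) l (hLB hl)
      · rintro _ ⟨y, hy, rfl⟩
        exact hC k (hKA hk) y (hLB hy)
    · exact (hL.image (by fun_prop)).measurableSet.nullMeasurableSet
    · -- the two pieces share only the point `a * k + b * l`
      refine measure_mono_null (t := {a * k + b * l}) ?_ (by simp)
      rintro z ⟨⟨x, hx, rfl⟩, ⟨y, hy, hxy⟩⟩
      have h1 := mul_le_mul_of_nonneg_left (hkmax hx) ha.le
      have h2 := mul_le_mul_of_nonneg_left (hlmin hy) hb.le
      simp only [mem_singleton_iff] at hxy ⊢
      linarith
  obtain ⟨x₀, hx₀⟩ := hA0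
  obtain ⟨y₀, hy₀⟩ := hB0
  rw [hA.measure_eq_iSup_isCompact, hB.measure_eq_iSup_isCompact]
  simp_rw [ENNReal.mul_iSup, iSup_and']
  refine ENNReal.biSup_add_biSup_le' ⟨∅, by simp⟩ ⟨∅, by simp⟩ ?_
  rintro K ⟨hKA, hK⟩ L ⟨hLB, hL⟩
  refine le_trans ?_ (key (insert x₀ K) (insert y₀ L) (hK.insert _) (hL.insert _)
    (insert_subset hx₀ hKA) (insert_subset hy₀ hLB) (insert_nonempty _ _) (insert_nonempty _ _))
  gcongr <;> exact subset_insert _ _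

/-- The Prékopa–Leindler inequality with weights `a` and `b`, as a property of a measure. -/
def PrekopaLeindler {V : Type*} [AddCommGroup V] [Module ℝ V] [MeasurableSpace V]
    (μ : Measure V) (a b : ℝ) : Prop :=
  ∀ f g h : V → ENNReal, Measurable f → Measurable g → Measurable h →
    (∀ x y, f x ^ a * g y ^ b ≤ h (a • x + b • y)) →
    (∫⁻ x, f x ∂μ) ^ a * (∫⁻ x, g x ∂μ) ^ b ≤ ∫⁻ x, h x ∂μ

theorem ennreal_rpow_mul_rpow_le {a b : ℝ} (ha : 0 < a) (hb : 0 < b) (hab : a + b = 1)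
    (x y : ENNReal) :
    x ^ a * y ^ b ≤ ENNReal.ofReal a * x + ENNReal.ofReal b * y := by
  by_cases hx : x = ⊤
  · simp [hx, ENNReal.mul_top, ha]
  by_cases hy : y = ⊤
  · simp [hy, ENNReal.mul_top, hb]
  lift x to NNReal using hx
  lift y to NNReal using hy
  have h := NNReal.geom_mean_le_arith_mean2_weighted a.toNNReal b.toNNReal x y
    (by rw [← Real.toNNReal_add ha.le hb.le, hab, Real.toNNReal_one])
  rw [Real.coe_toNNReal a ha.le, Real.coe_toNNReal b hb.le] at h
  rw [← ENNReal.coe_rpow_of_nonneg _ ha.le, ← ENNReal.coe_rpow_of_nonneg _ hb.le]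
  simp only [ENNReal.ofReal]
  exact_mod_cast h

theorem lintegral_eq_lintegral_meas_ofReal_lt {α : Type*} [MeasurableSpace α] (μ : Measure α)
    {u : α → ENNReal} (hu : Measurable u) (hu1 : ∀ x, u x ≤ 1) :
    ∫⁻ x, u x ∂μ = ∫⁻ t in Ioi (0 : ℝ), μ {x | ENNReal.ofReal t < u x} := by
  have hfin : ∀ x, u x ≠ ⊤ := fun x => ((hu1 x).trans_lt ENNReal.one_lt_top).ne
  have h1 := lintegral_eq_lintegral_meas_lt μ (f := fun x => (u x).toReal)
    (Filter.Eventually.of_forall fun x => ENNReal.toReal_nonneg) hu.ennreal_toReal.aemeasurable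
  simp only [ENNReal.ofReal_toReal (hfin _)] at h1
  rw [h1]
  refine setLIntegral_congr_fun measurableSet_Ioi fun t ht => ?_
  simp only [ENNReal.ofReal_lt_iff_lt_toReal (le_of_lt ht) (hfin _)]

/-- The inequality on the line for functions with supremum `1`: compare the superlevel sets. -/
theorem prekopaLeindler_real_of_sup_eq_one {a b : ℝ} (ha : 0 < a) (hb : 0 < b) (hab : a + b = 1)
    {f g h : ℝ → ENNReal} (hf : Measurable f) (hg : Measurable g) (hh : Measurable h)
    (H : ∀ x y, f x ^ a * g y ^ b ≤ h (a • x + b • y))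
    (hf1 : ∀ x, f x ≤ 1) (hf2 : ∀ t < 1, ∃ x, t < f x)
    (hg1 : ∀ x, g x ≤ 1) (hg2 : ∀ t < 1, ∃ x, t < g x) :
    (∫⁻ x, f x) ^ a * (∫⁻ x, g x) ^ b ≤ ∫⁻ x, h x := by
  have hm : Measurable fun x => min (h x) 1 := hh.min measurable_const
  have hmono : ∀ u : ℝ → ENNReal,
      Measurable fun t : ℝ => volume {x | ENNReal.ofReal t < u x} := by
    intro u
    refine Antitone.measurable fun s t hst => measure_mono fun x hx => ?_
    exact lt_of_le_of_lt (ENNReal.ofReal_le_ofReal hst) hx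
  calc (∫⁻ x, f x) ^ a * (∫⁻ x, g x) ^ b
      ≤ ENNReal.ofReal a * (∫⁻ x, f x) + ENNReal.ofReal b * ∫⁻ x, g x :=
        ennreal_rpow_mul_rpow_le ha hb hab _ _
    _ = ∫⁻ t in Ioi (0 : ℝ), (ENNReal.ofReal a * volume {x | ENNReal.ofReal t < f x} +
          ENNReal.ofReal b * volume {x | ENNReal.ofReal t < g x}) := by
        rw [lintegral_eq_lintegral_meas_ofReal_lt _ hf hf1,
          lintegral_eq_lintegral_meas_ofReal_lt _ hg hg1,
          lintegral_add_left ((hmono f).const_mul _), lintegral_const_mul _ (hmono f),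
          lintegral_const_mul _ (hmono g)]
    _ ≤ ∫⁻ t in Ioi (0 : ℝ), volume {x | ENNReal.ofReal t < min (h x) 1} := by
        refine setLIntegral_mono (hmono _) fun t ht => ?_
        have ht0 : (0 : ℝ) < t := ht
        rcases lt_or_ge t 1 with ht1 | ht1
        · have ht1' : ENNReal.ofReal t < 1 := by simpa using ht1
          refine add_volume_le_of_combo_subset (measurableSet_lt measurable_const hf)
            (measurableSet_lt measurable_const hg) (hf2 _ ht1') (hg2 _ ht1') ha hb ?_
          intro x hx y hy
          refine lt_min (lt_of_lt_of_le ?_ (H x y)) ht1'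
          have e : ENNReal.ofReal t = ENNReal.ofReal t ^ a * ENNReal.ofReal t ^ b := by
            rw [← ENNReal.rpow_add _ _ (by simpa using ht0) ENNReal.ofReal_ne_top, hab,
              ENNReal.rpow_one]
          rw [e]
          exact ENNReal.mul_lt_mul (ENNReal.rpow_lt_rpow hx ha) (ENNReal.rpow_lt_rpow hy hb)
        · have h1 : (1 : ENNReal) ≤ ENNReal.ofReal t := by simpa using ht1
          have e : ∀ u : ℝ → ENNReal, (∀ x, u x ≤ 1) → {x | ENNReal.ofReal t < u x} = ∅ := by
            intro u hu
            ext x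
            simpa using (hu x).trans h1
          simp [e f hf1, e g hg1]
    _ = ∫⁻ x, min (h x) 1 :=
        (lintegral_eq_lintegral_meas_ofReal_lt _ hm fun x => min_le_right _ _).symm
    _ ≤ ∫⁻ x, h x := lintegral_mono fun x => min_le_left _ _

theorem prekopaLeindler_real_of_bounded {a b : ℝ} (ha : 0 < a) (hb : 0 < b) (hab : a + b = 1)
    {f g h : ℝ → ENNReal} (hf : Measurable f) (hg : Measurable g) (hh : Measurable h)
    (H : ∀ x y, f x ^ a * g y ^ b ≤ h (a • x + b • y)) {M : ENNReal} (hM : M ≠ ⊤)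
    (hfM : ∀ x, f x ≤ M) (hgM : ∀ x, g x ≤ M) :
    (∫⁻ x, f x) ^ a * (∫⁻ x, g x) ^ b ≤ ∫⁻ x, h x := by
  set F := ⨆ x, f x
  set G := ⨆ x, g x
  have hFt : F ≠ ⊤ := ((iSup_le hfM).trans_lt hM.lt_top).ne
  have hGt : G ≠ ⊤ := ((iSup_le hgM).trans_lt hM.lt_top).ne
  by_cases hF0 : F = 0
  · have : ∀ x, f x = 0 := fun x => le_antisymm (hF0 ▸ le_iSup f x) bot_le
    simp [this, ENNReal.zero_rpow_of_pos ha]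
  by_cases hG0 : G = 0
  · have : ∀ x, g x = 0 := fun x => le_antisymm (hG0 ▸ le_iSup g x) bot_le
    simp [this, ENNReal.zero_rpow_of_pos hb]
  have hFa0 : F ^ a ≠ 0 := by simp [ENNReal.rpow_eq_zero_iff, hF0, hFt]
  have hFat : F ^ a ≠ ⊤ := ENNReal.rpow_ne_top_of_nonneg ha.le hFt
  have hGb0 : G ^ b ≠ 0 := by simp [ENNReal.rpow_eq_zero_iff, hG0, hGt]
  have hGbt : G ^ b ≠ ⊤ := ENNReal.rpow_ne_top_of_nonneg hb.le hGt
  have hnorm : ∀ (u : ℝ → ENNReal), (⨆ x, u x) ≠ 0 → (⨆ x, u x) ≠ ⊤ →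
      (∀ x, (⨆ x, u x)⁻¹ * u x ≤ 1) ∧ ∀ t < 1, ∃ x, t < (⨆ x, u x)⁻¹ * u x := by
    intro u h0 ht
    refine ⟨fun x => ?_, fun t ht1 => ?_⟩
    · rw [← ENNReal.inv_mul_cancel h0 ht]
      gcongr
      exact le_iSup u x
    · have h1 : t < ⨆ x, (⨆ x, u x)⁻¹ * u x := by
        rwa [← ENNReal.mul_iSup, ENNReal.inv_mul_cancel h0 ht]
      exact lt_iSup_iff.1 h1
  obtain ⟨hf1, hf2⟩ := hnorm f hF0 hFt
  obtain ⟨hg1, hg2⟩ := hnorm g hG0 hGt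
  have := prekopaLeindler_real_of_sup_eq_one ha hb hab (hf.const_mul F⁻¹) (hg.const_mul G⁻¹)
    (hh.const_mul ((F ^ a)⁻¹ * (G ^ b)⁻¹)) (fun x y => by
      rw [ENNReal.mul_rpow_of_nonneg _ _ ha.le, ENNReal.mul_rpow_of_nonneg _ _ hb.le,
        ENNReal.inv_rpow, ENNReal.inv_rpow, mul_mul_mul_comm]
      gcongr
      exact H x y) hf1 hf2 hg1 hg2
  rw [lintegral_const_mul _ hf, lintegral_const_mul _ hg, lintegral_const_mul _ hh,
    ENNReal.mul_rpow_of_nonneg _ _ ha.le, ENNReal.mul_rpow_of_nonneg _ _ hb.le,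
    ENNReal.inv_rpow, ENNReal.inv_rpow, mul_mul_mul_comm] at this
  refine (ENNReal.mul_le_mul_iff_right (mul_ne_zero (ENNReal.inv_ne_zero.2 hFat)
    (ENNReal.inv_ne_zero.2 hGbt)) (ENNReal.mul_ne_top (ENNReal.inv_ne_top.2 hFa0)
    (ENNReal.inv_ne_top.2 hGb0))).1 this

theorem prekopaLeindler_real {a b : ℝ} (ha : 0 < a) (hb : 0 < b) (hab : a + b = 1) :
    PrekopaLeindler (volume : Measure ℝ) a b := by
  intro f g h hf hg hh H
  by_cases hA : ∫⁻ x, f x = 0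
  · simp [hA, ENNReal.zero_rpow_of_pos ha]
  by_cases hB : ∫⁻ x, g x = 0
  · simp [hB, ENNReal.zero_rpow_of_pos hb]
  -- truncate `f` and `g` at height `k` and let `k` tend to infinity
  have htr : ∀ u : ℝ → ENNReal, Measurable u →
      Filter.Tendsto (fun k : ℕ => ∫⁻ x, min (u x) k) Filter.atTop (nhds (∫⁻ x, u x)) := by
    intro u hu
    refine lintegral_tendsto_of_tendsto_of_monotone
      (fun k => (hu.min measurable_const).aemeasurable)
      (Filter.Eventually.of_forall fun x k l hkl => ?_) (Filter.Eventually.of_forall fun x => ?_)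
    · dsimp only
      gcongr
    · have : Filter.Tendsto (fun k : ℕ => min (u x) (k : ENNReal)) Filter.atTop
          (nhds (min (u x) ⊤)) :=
        tendsto_const_nhds.min ENNReal.tendsto_nat_nhds_top
      simpa using this
  have hA' : (∫⁻ x, f x) ^ a ≠ 0 := by
    simp [ENNReal.rpow_eq_zero_iff, hA, ha.le]
  have hB' : (∫⁻ x, g x) ^ b ≠ 0 := by
    simp [ENNReal.rpow_eq_zero_iff, hB, hb.le]
  refine le_of_tendsto' (ENNReal.Tendsto.mul ((htr f hf).ennrpow_const a) (Or.inl hA')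
    ((htr g hg).ennrpow_const b) (Or.inl hB')) fun k => ?_
  refine prekopaLeindler_real_of_bounded ha hb hab (hf.min measurable_const)
    (hg.min measurable_const) hh (fun x y => le_trans ?_ (H x y))
    (ENNReal.natCast_ne_top k) (fun x => min_le_right _ _) (fun x => min_le_right _ _)
  gcongr <;> exact min_le_left _ _

theorem PrekopaLeindler.prod {V W : Type*} [AddCommGroup V] [Module ℝ V] [MeasurableSpace V]
    [AddCommGroup W] [Module ℝ W] [MeasurableSpace W] {μ : Measure V} {ν : Measure W}
    [SFinite ν] {a b : ℝ} (hμ : PrekopaLeindler μ a b) (hν : PrekopaLeindler ν a b) :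
    PrekopaLeindler (μ.prod ν) a b := by
  intro f g h hf hg hh H
  rw [lintegral_prod _ hf.aemeasurable, lintegral_prod _ hg.aemeasurable,
    lintegral_prod _ hh.aemeasurable]
  refine hμ _ _ _ hf.lintegral_prod_right' hg.lintegral_prod_right' hh.lintegral_prod_right'
    fun x x' => ?_
  exact hν _ _ _ (hf.comp measurable_prodMk_left) (hg.comp measurable_prodMk_left)
    (hh.comp measurable_prodMk_left) fun y y' => H (x, y) (x', y')

theorem PrekopaLeindler.of_measurePreserving {V W : Type*} [AddCommGroup V] [Module ℝ V]
    [MeasurableSpace V] [AddCommGroup W] [Module ℝ W] [MeasurableSpace W] {μ : Measure V}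
    {ν : Measure W} {a b : ℝ} (hμ : PrekopaLeindler μ a b) {T : V → W}
    (hT : MeasurePreserving T μ ν) (hlin : ∀ x y, T (a • x + b • y) = a • T x + b • T y) :
    PrekopaLeindler ν a b := by
  intro f g h hf hg hh H
  rw [← hT.lintegral_comp hf, ← hT.lintegral_comp hg, ← hT.lintegral_comp hh]
  exact hμ _ _ _ (hf.comp hT.measurable) (hg.comp hT.measurable) (hh.comp hT.measurable)
    fun x y => by simpa only [Function.comp, hlin] using H (T x) (T y)

theorem prekopaLeindler_pi {a b : ℝ} (ha : 0 < a) (hb : 0 < b) (hab : a + b = 1) (n : ℕ) :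
    PrekopaLeindler (volume : Measure (Fin n → ℝ)) a b := by
  induction n with
  | zero =>
    intro f g h hf hg hh H
    rw [Measure.volume_pi_eq_dirac 0, lintegral_dirac, lintegral_dirac, lintegral_dirac]
    simpa using H 0 0
  | succ k ih =>
    refine ((prekopaLeindler_real ha hb hab).prod ih).of_measurePreserving
      (volume_preserving_piFinSuccAbove (fun _ => ℝ) 0).symm fun x y => ?_
    ext i
    refine Fin.cases ?_ (fun j => ?_) i <;> simp [MeasurableEquiv.piFinSuccAbove]

/-- The Brunn–Minkowski inequality in the form: `a A + b B` is at least as large as the smaller of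
`A` and `B`. -/
theorem le_volume_of_combo_subset {V : Type*} [NormedAddCommGroup V] [InnerProductSpace ℝ V]
    [FiniteDimensional ℝ V] [MeasurableSpace V] [BorelSpace V] {A B C : Set V} (hA : MeasurableSet A)
    (hB : MeasurableSet B) (hC : MeasurableSet C) {a b : ℝ} (ha : 0 < a) (hb : 0 < b)
    (hab : a + b = 1) (hABC : ∀ x ∈ A, ∀ y ∈ B, a • x + b • y ∈ C) {v : ENNReal}
    (hvA : v ≤ volume A) (hvB : v ≤ volume B) : v ≤ volume C := by
  have hPL : PrekopaLeindler (volume : Measure V) a b :=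
    ((prekopaLeindler_pi ha hb hab _).of_measurePreserving
      (PiLp.volume_preserving_toLp _) fun x y => by simp).of_measurePreserving
      (stdOrthonormalBasis ℝ V).measurePreserving_repr_symm fun x y => by simp
  have h := hPL (A.indicator 1) (B.indicator 1) (C.indicator 1) (measurable_one.indicator hA)
    (measurable_one.indicator hB) (measurable_one.indicator hC) fun x y => by
      by_cases hx : x ∈ A
      · by_cases hy : y ∈ B
        · simp [hx, hy, hABC x hx y hy]
        · simp [hy, ENNReal.zero_rpow_of_pos hb]
      · simp [hx, ENNReal.zero_rpow_of_pos ha]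
  rw [lintegral_indicator_one hA, lintegral_indicator_one hB, lintegral_indicator_one hC] at h
  refine le_trans ?_ h
  calc v = v ^ a * v ^ b := by
        rw [← ENNReal.rpow_add_of_nonneg _ _ ha.le hb.le, hab, ENNReal.rpow_one]
    _ ≤ _ := by gcongr

section Rotations

variable {V : Type*} [NormedAddCommGroup V] [InnerProductSpace ℝ V]

/-! ### Wulff shapes -/

/-- The Wulff shape of a function `g` on the sphere of radius `s`: the largest convex set whose
support function is at most `g` on that sphere. -/
def wulff {s : ℝ} (g : C(sphere (0 : V) s, ℝ)) : Set V :=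
  {x | ∀ q : sphere (0 : V) s, inner ℝ x (q : V) ≤ g q}

theorem isClosed_wulff {s : ℝ} (g : C(sphere (0 : V) s, ℝ)) : IsClosed (wulff g) := by
  simp only [wulff, ofPred_forall]
  exact isClosed_iInter fun q => isClosed_le (by fun_prop) continuous_const

theorem wulff_mono {s : ℝ} {g g' : C(sphere (0 : V) s, ℝ)} (h : ∀ q, g q ≤ g' q) :
    wulff g ⊆ wulff g' := fun _ hx q => (hx q).trans (h q)

theorem norm_mul_le_of_mem_wulff {s w : ℝ} (hs : 0 < s)
    {g : C(sphere (0 : V) s, ℝ)} (hg : ∀ q, g q ≤ w) {x : V} (hx : x ∈ wulff g)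
    (hx0 : x ≠ 0) : ‖x‖ * s ≤ w := by
  have hn : ‖x‖ ≠ 0 := norm_ne_zero_iff.2 hx0
  have hq : (s / ‖x‖) • x ∈ sphere (0 : V) s := by
    rw [mem_sphere_zero_iff_norm, norm_smul, Real.norm_of_nonneg (by positivity),
      div_mul_cancel₀ _ hn]
  have h := (hx ⟨_, hq⟩).trans (hg _)
  rw [real_inner_smul_right, real_inner_self_eq_norm_sq] at h
  calc ‖x‖ * s = s / ‖x‖ * ‖x‖ ^ 2 := by field_simp
    _ ≤ w := h

section Volume

variable [FiniteDimensional ℝ V] [MeasurableSpace V] [BorelSpace V]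

theorem volume_wulff_ne_top {s : ℝ} (hs : 0 < s) (g : C(sphere (0 : V) s, ℝ)) :
    volume (wulff g) ≠ ⊤ := by
  refine (lt_of_le_of_lt (measure_mono (t := closedBall 0 (‖g‖ / s)) fun x hx => ?_)
    measure_closedBall_lt_top).ne
  rw [mem_closedBall_zero_iff]
  by_cases hx0 : x = 0
  · rw [hx0, norm_zero]; positivity
  · rw [le_div_iff₀ hs]
    exact norm_mul_le_of_mem_wulff hs (fun q => (le_abs_self _).trans (g.norm_coe_le_norm q)) hx hx0

theorem isClosed_setOf_le_volume_wulff {s : ℝ} (hs : 0 < s) (v : ENNReal) :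
    IsClosed {g : C(sphere (0 : V) s, ℝ) | v ≤ volume (wulff g)} := by
  refine isClosed_of_closure_subset fun g hg => ?_
  let u : ℕ → Set V := fun k =>
    wulff (g + ContinuousMap.const _ (1 / ((k : ℝ) + 1)))
  have hu : ⋂ k, u k = wulff g := by
    ext x
    simp only [u, wulff, mem_iInter, mem_ofPred_eq, ContinuousMap.add_apply,
      ContinuousMap.const_apply]
    refine ⟨fun h q => ?_, fun h k q => (h q).trans (by simp; positivity)⟩
    have ht : Filter.Tendsto (fun k : ℕ => g q + 1 / ((k : ℝ) + 1)) Filter.atTop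
        (nhds (g q + 0)) := tendsto_const_nhds.add tendsto_one_div_add_atTop_nhds_zero_nat
    rw [add_zero] at ht
    exact ge_of_tendsto' ht fun k => h k q
  have hanti : Antitone u := fun k l hkl => wulff_mono fun q => by
    have := Nat.one_div_le_one_div (α := ℝ) hkl
    simpa using this
  have ht := tendsto_measure_iInter_atTop (μ := (volume : Measure V))
    (fun k => (isClosed_wulff _).measurableSet.nullMeasurableSet) hanti
    ⟨0, volume_wulff_ne_top hs _⟩
  rw [hu] at ht
  refine ge_of_tendsto' ht fun k => ?_
  obtain ⟨g', hg', hd⟩ := Metric.mem_closure_iff.1 hg (1 / ((k : ℝ) + 1)) (by positivity)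
  refine le_trans hg' (measure_mono (wulff_mono fun q => ?_))
  have h1 := (ContinuousMap.dist_apply_le_dist (f := g) (g := g') q).trans hd.le
  rw [Real.dist_eq] at h1
  have h2 := neg_le_of_abs_le h1
  simp only [ContinuousMap.add_apply, ContinuousMap.const_apply]
  linarith

theorem convex_setOf_le_volume_wulff {s : ℝ} (v : ENNReal) :
    Convex ℝ {g : C(sphere (0 : V) s, ℝ) | v ≤ volume (wulff g)} := by
  rw [convex_iff_forall_pos]
  intro g hg g' hg' a b ha hb hab
  refine le_volume_of_combo_subset (isClosed_wulff g).measurableSet (isClosed_wulff g').measurableSet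
    (isClosed_wulff _).measurableSet ha hb hab (fun x hx y hy q => ?_) hg hg'
  rw [inner_add_left, real_inner_smul_left, real_inner_smul_left]
  have h1 := mul_le_mul_of_nonneg_left (hx q) ha.le
  have h2 := mul_le_mul_of_nonneg_left (hy q) hb.le
  simpa using add_le_add h1 h2

end Volume

/-! ### Averaging over rotations -/

/-- The orthogonal group of `V`. -/
abbrev Rotation (V : Type*) [NormedAddCommGroup V] [InnerProductSpace ℝ V] [CompleteSpace V] :
    Type _ := unitary (V →L[ℝ] V)

variable [CompleteSpace V]

instance : ContinuousStar (V →L[ℝ] V) :=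
  ⟨(ContinuousLinearMap.adjoint (𝕜 := ℝ) (E := V) (F := V)).continuous⟩

/-- The action of the inverse of a rotation on `V`. -/
noncomputable def invRotate (ρ : Rotation V) (p : V) : V :=
  ((ρ⁻¹ : Rotation V) : V →L[ℝ] V) p

theorem norm_invRotate (ρ : Rotation V) (p : V) : ‖invRotate ρ p‖ = ‖p‖ :=
  Unitary.norm_map _ _

theorem continuous_invRotate (V : Type*) [NormedAddCommGroup V] [InnerProductSpace ℝ V]
    [CompleteSpace V] :
    Continuous fun z : Rotation V × V => invRotate z.1 z.2 := by
  have h1 : Continuous fun z : Rotation V × V => ((z.1⁻¹ : Rotation V) : V →L[ℝ] V) :=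
    continuous_subtype_val.comp continuous_fst.inv
  exact h1.clm_apply continuous_snd

theorem exists_rotation_apply_eq {p q : V} (h : ‖p‖ = ‖q‖) :
    ∃ σ : Rotation V, (σ : V →L[ℝ] V) p = q := by
  refine ⟨Unitary.linearIsometryEquiv.symm (Submodule.reflection (Submodule.span ℝ {p - q})ᗮ), ?_⟩
  rw [Unitary.coe_symm_linearIsometryEquiv_apply]
  exact Submodule.reflection_sub h

theorem invRotate_apply (ρ : Rotation V) (p : V) :
    invRotate ρ ((ρ : V →L[ℝ] V) p) = p := by
  rw [invRotate, ← mul_apply_eq_comp, ← Submonoid.coe_mul, inv_mul_cancel]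
  rfl

theorem apply_invRotate (ρ : Rotation V) (p : V) :
    (ρ : V →L[ℝ] V) (invRotate ρ p) = p := by
  rw [invRotate, ← mul_apply_eq_comp, ← Submonoid.coe_mul, mul_inv_cancel]
  rfl

variable [FiniteDimensional ℝ V]

instance : CompactSpace (Rotation V) := by
  refine isCompact_iff_compactSpace.1 ?_
  refine Metric.isCompact_of_isClosed_isBounded isClosed_unitary ?_
  refine (isBounded_iff_forall_norm_le).2 ⟨1, fun u hu => ?_⟩
  refine ContinuousLinearMap.opNorm_le_bound _ zero_le_one fun x => ?_
  rw [u.norm_map_of_mem_unitary hu x, one_mul]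

/-- The Haar probability measure of the orthogonal group. -/
noncomputable def rotationMeasure (V : Type*) [NormedAddCommGroup V] [InnerProductSpace ℝ V]
    [FiniteDimensional ℝ V] [CompleteSpace V] : Measure (Rotation V) :=
  Measure.haarMeasure ⊤

instance : IsProbabilityMeasure (rotationMeasure V) :=
  ⟨by simpa [rotationMeasure] using
    Measure.haarMeasure_self (K₀ := (⊤ : TopologicalSpace.PositiveCompacts (Rotation V)))⟩

instance : (rotationMeasure V).IsMulLeftInvariant := by
  unfold rotationMeasure; infer_instance

/-- The average of `g` over the sphere through `p`, as an average over rotations. -/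
noncomputable def rotationAverage (g : V → ℝ) (p : V) : ℝ :=
  ∫ ρ : Rotation V, g (invRotate ρ p) ∂(rotationMeasure V)

theorem rotationAverage_eq_of_norm_eq (g : V → ℝ) {p q : V} (h : ‖p‖ = ‖q‖) :
    rotationAverage g q = rotationAverage g p := by
  obtain ⟨σ, rfl⟩ := exists_rotation_apply_eq h
  rw [rotationAverage, rotationAverage, ← integral_mul_left_eq_self _ σ]
  congr with ρ
  rw [invRotate, mul_inv_rev, Submonoid.coe_mul, mul_apply_eq_comp, ← invRotate, ← invRotate,
    invRotate_apply]

theorem integrable_of_continuous_compactSpace {X F : Type*} [TopologicalSpace X] [CompactSpace X]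
    [MeasurableSpace X] [BorelSpace X] [NormedAddCommGroup F] {μ : Measure X} [IsFiniteMeasure μ]
    {f : X → F} (hf : Continuous f) : Integrable f μ :=
  hf.integrable_of_hasCompactSupport (HasCompactSupport.of_compactSpace f)

theorem integrable_rotation {g : V → ℝ} (hg : Continuous g) (p : V) :
    Integrable (fun ρ : Rotation V => g (invRotate ρ p)) (rotationMeasure V) := by
  have h1 : Continuous fun ρ : Rotation V => (ρ, p) := .prodMk_left p
  have h2 : Continuous fun ρ : Rotation V => invRotate ρ p := by
    have h := Continuous.comp (continuous_invRotate V) h1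
    exact h
  have h : Continuous fun ρ : Rotation V => g (invRotate ρ p) := hg.comp h2
  exact integrable_of_continuous_compactSpace (X := Rotation V) (μ := rotationMeasure V) h

theorem rotationAverage_add_const {g : V → ℝ} (hg : Continuous g) (a : ℝ) (p : V) :
    rotationAverage (fun q => g q + a) p = rotationAverage g p + a := by
  rw [rotationAverage, integral_add (integrable_rotation hg p) (integrable_const a)]
  simp [rotationAverage]

theorem rotationAverage_zero (g : V → ℝ) : rotationAverage g 0 = g 0 := by
  simp [rotationAverage, invRotate]

variable [MeasurableSpace V] [BorelSpace V]

theorem measurePreserving_rotation (ρ : Rotation V) :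
    MeasurePreserving (ρ : V →L[ℝ] V) (volume : Measure V) volume :=
  (Unitary.linearIsometryEquiv ρ).measurePreserving

theorem lintegral_eq_lintegral_rotationAverage {g : V → ℝ} (hg : Continuous g)
    (hg0 : ∀ p, 0 ≤ g p) :
    ∫⁻ p, ENNReal.ofReal (g p) = ∫⁻ p : V, ENNReal.ofReal (rotationAverage g p) := by
  have h1 : ∀ p : V, ENNReal.ofReal (rotationAverage g p) =
      ∫⁻ ρ : Rotation V, ENNReal.ofReal (g (invRotate ρ p))
        ∂(rotationMeasure V) := fun p =>
    ofReal_integral_eq_lintegral_ofReal (integrable_rotation hg p)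
      (Filter.Eventually.of_forall fun ρ => hg0 _)
  have hm : Measurable fun z : V × Rotation V =>
      ENNReal.ofReal (g (invRotate z.2 z.1)) :=
    (ENNReal.continuous_ofReal.comp (hg.comp ((continuous_invRotate V).comp
      continuous_swap))).measurable
  have h2 : ∀ ρ : Rotation V,
      ∫⁻ p : V, ENNReal.ofReal (g (invRotate ρ p)) =
        ∫⁻ p : V, ENNReal.ofReal (g p) := fun ρ =>
    (measurePreserving_rotation ρ⁻¹).lintegral_comp (hg.measurable.ennreal_ofReal)
  simp_rw [h1]
  rw [lintegral_lintegral_swap hm.aemeasurable]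
  simp [h2]

/-! ### Urysohn's inequality -/

/-- Urysohn's inequality: a set larger than a ball has a larger mean width. The support function
enters through an upper bound `g` on the sphere of radius `s`, and the mean through an average
over rotations. The functions whose Wulff shape has at least a given volume form a closed convex
set, so the average of the rotated copies of `g`, a constant, belongs to it. -/
theorem mul_le_rotationAverage {K : Set V} {r s : ℝ} (hs : 0 < s)
    (hK : volume (ball (0 : V) r) < volume K) {g : V → ℝ} (hg : Continuous g)
    (hKg : ∀ x ∈ K, ∀ q : V, ‖q‖ = s → inner ℝ x q ≤ g q) {p : V} (hp : ‖p‖ = s) :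
    r * s ≤ rotationAverage g p := by
  have hc1 : Continuous fun z : Rotation V × sphere (0 : V) s => (z.1, (z.2 : V)) :=
    continuous_fst.prodMk (continuous_subtype_val.comp continuous_snd)
  have hc2 : Continuous fun z : Rotation V × sphere (0 : V) s => invRotate z.1 z.2 := by
    have h := Continuous.comp (continuous_invRotate V) hc1
    exact h
  have hc : Continuous fun z : Rotation V × sphere (0 : V) s => g (invRotate z.1 z.2) :=
    hg.comp hc2
  let f : Rotation V → C(sphere (0 : V) s, ℝ) := fun ρ =>
    ⟨fun q => g (invRotate ρ q),
      by have h := Continuous.comp hc (Continuous.prodMk_right ρ); exact h⟩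
  have hfc : Continuous f := ContinuousMap.continuous_of_continuous_uncurry f hc
  have hfi : Integrable f (rotationMeasure V) :=
    integrable_of_continuous_compactSpace (X := Rotation V) (μ := rotationMeasure V) hfc
  have hf : ∀ ρ, f ρ ∈ {g : C(sphere (0 : V) s, ℝ) | volume K ≤ volume (wulff g)} := by
    intro ρ
    rw [mem_ofPred_eq, ← (measurePreserving_rotation ρ).measure_preimage
      (isClosed_wulff _).measurableSet.nullMeasurableSet]
    refine measure_mono fun x hx q => ?_
    have h1 := hKg x hx (invRotate ρ q)
      (by rw [norm_invRotate]; simp)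
    rwa [← Unitary.inner_map_map ρ, apply_invRotate] at h1
  have hmem := (convex_setOf_le_volume_wulff (volume K)).integral_mem
    (isClosed_setOf_le_volume_wulff hs (volume K)) (Filter.Eventually.of_forall hf) hfi
  set w := rotationAverage g p
  have hconst : ∀ q, (∫ ρ, f ρ ∂(rotationMeasure V)) q = w := by
    intro q
    have h1 := (ContinuousMap.evalCLM ℝ q).integral_comp_comm hfi
    simp only [ContinuousMap.evalCLM_apply] at h1
    rw [← h1]
    exact rotationAverage_eq_of_norm_eq g (by rw [hp]; simp)
  by_contra! hlt
  refine absurd (hK.trans_le hmem) (not_lt.2 (measure_mono fun x hx => ?_))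
  rw [mem_ball_zero_iff]
  by_cases hx0 : x = 0
  · have h1 := hx ⟨p, by simpa using hp⟩
    rw [hconst, hx0, inner_zero_left] at h1
    rw [hx0, norm_zero]
    exact pos_of_mul_pos_left (h1.trans_lt hlt) hs.le
  · have h1 := norm_mul_le_of_mem_wulff hs (fun q => (hconst q).le) hx hx0
    exact lt_of_mul_lt_mul_right (h1.trans_lt hlt) hs.le

end Rotations

/-! ### Convex functions on a ball and their symmetrization -/

theorem ConvexOn.closedBall_of_ball {F : Type*} [NormedAddCommGroup F] [NormedSpace ℝ F] {c : F}
    {R : ℝ} {φ : F → ℝ} (hconv : ConvexOn ℝ (ball c R) φ)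
    (hcont : ContinuousOn φ (closedBall c R)) : ConvexOn ℝ (closedBall c R) φ := by
  refine ⟨convex_closedBall c R, fun x hx y hy a b ha hb hab => ?_⟩
  have hmem : ∀ z ∈ closedBall c R, ∀ s ∈ Icc (0 : ℝ) 1, c + s • (z - c) ∈ closedBall c R := by
    intro z hz s hs
    rw [mem_closedBall_iff_norm] at hz ⊢
    rw [add_sub_cancel_left, norm_smul, Real.norm_of_nonneg hs.1]
    exact (mul_le_of_le_one_left (norm_nonneg _) hs.2).trans hz
  have hmem' : ∀ z ∈ closedBall c R, 0 < R → ∀ s ∈ Ico (0 : ℝ) 1, c + s • (z - c) ∈ ball c R := by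
    intro z hz hR s hs
    rw [mem_closedBall_iff_norm] at hz
    rw [mem_ball_iff_norm, add_sub_cancel_left, norm_smul, Real.norm_of_nonneg hs.1]
    nlinarith [hs.1, hs.2, norm_nonneg (z - c)]
  rcases lt_or_ge 0 R with hR | hR
  · have hz : a • x + b • y ∈ closedBall c R := convex_closedBall c R hx hy ha hb hab
    have hray : ∀ z ∈ closedBall c R,
        ContinuousOn (fun s : ℝ => φ (c + s • (z - c))) (closure (Ico 0 1)) := by
      intro z hz
      rw [closure_Ico zero_ne_one]
      exact hcont.comp (by fun_prop) (hmem z hz)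
    have h := le_on_closure (s := Ico (0 : ℝ) 1)
      (f := fun s => φ (c + s • (a • x + b • y - c)))
      (g := fun s => a * φ (c + s • (x - c)) + b * φ (c + s • (y - c))) (fun s hs => by
        have h1 := hconv.2 (hmem' x hx hR s hs) (hmem' y hy hR s hs) ha hb hab
        have e : a • (c + s • (x - c)) + b • (c + s • (y - c)) =
            c + s • (a • x + b • y - c) := by
          have hb' : b = 1 - a := by linarith
          subst hb'
          module
        rwa [e] at h1) (hray _ hz)
      (((hray x hx).const_smul a).add ((hray y hy).const_smul b))
      (x := 1) (by rw [closure_Ico zero_ne_one]; simp)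
    simpa using h
  · have h0 : ∀ z ∈ closedBall c R, z = c := fun z hz => by
      rw [mem_closedBall] at hz
      exact dist_le_zero.1 (hz.trans hR)
    have e : a • x + b • y = c := h0 _ (convex_closedBall c R hx hy ha hb hab)
    rw [e, h0 x hx, h0 y hy, ← add_smul, hab, one_smul]

theorem ConvexOn.nonpos_of_sphere {F : Type*} [NormedAddCommGroup F] [NormedSpace ℝ F]
    [Nontrivial F] {c : F} {R : ℝ} (hR : 0 ≤ R) {φ : F → ℝ}
    (hconv : ConvexOn ℝ (closedBall c R) φ) (hφ : ∀ x ∈ sphere c R, φ x = 0) :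
    ∀ x ∈ closedBall c R, φ x ≤ 0 := by
  intro x hx
  rw [← convexHull_sphere_eq_closedBall c hR] at hx hconv
  obtain ⟨y, hy, hxy⟩ := hconv.exists_ge_of_mem_convexHull (subset_convexHull ℝ _) hx
  exact hxy.trans (hφ y hy).le

section Schwarz

variable {n : ℕ} {c : E n} {R m : ℝ} {φ : E n → ℝ}

theorem nontrivial_of_one_le (hn : 1 ≤ n) : Nontrivial (E n) :=
  Module.nontrivial_of_finrank_pos (R := ℝ) (by simp; omega)

theorem volume_ball_lt_volume_ball (hn : 1 ≤ n) (c : E n) {r : ℝ} (hr : 0 ≤ r) (hrR : r < R) :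
    volume (ball (0 : E n) r) < volume (ball c R) := by
  have := nontrivial_of_one_le hn
  rw [Measure.addHaar_ball _ _ hr, Measure.addHaar_ball _ _ (hr.trans hrR.le)]
  rw [ENNReal.mul_lt_mul_iff_left (measure_ball_pos volume _ one_pos).ne'
    measure_ball_lt_top.ne, ENNReal.ofReal_lt_ofReal_iff_of_nonneg (by positivity)]
  exact pow_lt_pow_left₀ hrR hr (by simp; omega)

theorem continuous_volume_ball_norm (hn : 1 ≤ n) :
    Continuous fun x : E n => volume (ball (0 : E n) ‖x‖) := by
  have := nontrivial_of_one_le hn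
  have h : (fun x : E n => volume (ball (0 : E n) ‖x‖)) = fun x =>
      ENNReal.ofReal (‖x‖ ^ Module.finrank ℝ (E n)) * volume (ball (0 : E n) 1) := by
    ext x
    exact Measure.addHaar_ball _ _ (norm_nonneg x)
  rw [h]
  exact ENNReal.continuous_mul_const measure_ball_lt_top.ne |>.comp
    (ENNReal.continuous_ofReal.comp (by fun_prop))

theorem schwarz_bddBelow (hm : ∀ y ∈ ball c R, |φ y| ≤ m) (x : E n) :
    BddBelow {t : ℝ | volume (ball (0 : E n) ‖x‖) < volume {y ∈ ball c R | φ y < t}} := by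
  refine ⟨-m, fun t ht => ?_⟩
  by_contra hlt
  have h1 : {y ∈ ball c R | φ y < t} = ∅ := by
    ext y
    simp only [mem_ofPred_eq, mem_empty_iff_false, iff_false, not_and, not_lt]
    intro hy
    linarith [neg_abs_le (φ y), hm y hy]
  rw [mem_ofPred_eq, h1, measure_empty] at ht
  exact not_lt_bot ht

theorem mem_schwarz_of_forall_lt (hn : 1 ≤ n) {x : E n} (hx : ‖x‖ < R) {t : ℝ}
    (ht : ∀ y ∈ ball c R, φ y < t) :
    t ∈ {t : ℝ | volume (ball (0 : E n) ‖x‖) < volume {y ∈ ball c R | φ y < t}} := by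
  have h1 : {y ∈ ball c R | φ y < t} = ball c R := by
    ext y
    simpa using ht y
  rw [mem_ofPred_eq, h1]
  exact volume_ball_lt_volume_ball hn c (norm_nonneg x) hx

theorem schwarz_nonempty (hn : 1 ≤ n) (hm : ∀ y ∈ ball c R, |φ y| ≤ m) {x : E n} (hx : ‖x‖ < R) :
    {t : ℝ | volume (ball (0 : E n) ‖x‖) < volume {y ∈ ball c R | φ y < t}}.Nonempty :=
  ⟨m + 1, mem_schwarz_of_forall_lt hn hx fun y hy => by
    linarith [le_abs_self (φ y), hm y hy]⟩

theorem volume_ball_lt_of_schwarz_lt (hn : 1 ≤ n) (hm : ∀ y ∈ ball c R, |φ y| ≤ m) {x : E n}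
    (hx : ‖x‖ < R) {t : ℝ} (ht : schwarz (ball c R) φ x < t) :
    volume (ball (0 : E n) ‖x‖) < volume {y ∈ ball c R | φ y < t} := by
  obtain ⟨s, hs, hst⟩ := exists_lt_of_csInf_lt (schwarz_nonempty hn hm hx) ht
  exact lt_of_lt_of_le hs (measure_mono fun y hy => ⟨hy.1, hy.2.trans hst⟩)

theorem schwarz_nonpos (hn : 1 ≤ n) (hm : ∀ y ∈ ball c R, |φ y| ≤ m)
    (h0 : ∀ y ∈ ball c R, φ y ≤ 0) {x : E n} (hx : ‖x‖ < R) : schwarz (ball c R) φ x ≤ 0 := by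
  refine le_of_forall_pos_le_add fun ε hε => csInf_le (schwarz_bddBelow hm x) ?_
  exact mem_schwarz_of_forall_lt hn hx fun y hy => by linarith [h0 y hy]

theorem neg_le_schwarz (hn : 1 ≤ n) (hm : ∀ y ∈ ball c R, |φ y| ≤ m) {x : E n}
    (hx : ‖x‖ < R) : -m ≤ schwarz (ball c R) φ x := by
  refine le_csInf (schwarz_nonempty hn hm hx) fun t ht => ?_
  obtain ⟨y, hy, hyt⟩ := nonempty_of_measure_ne_zero (pos_of_gt ht).ne'
  linarith [neg_abs_le (φ y), hm y hy]

/-- The distribution function of a continuous function on a ball has no flat part below the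
volume of the ball, except where it vanishes. -/
theorem volume_sublevel_lt (hφ : ContinuousOn φ (ball c R)) {t t' : ℝ} (htt' : t < t')
    (h0 : volume {y ∈ ball c R | φ y < t} ≠ 0)
    (h1 : volume {y ∈ ball c R | φ y < t'} < volume (ball c R)) :
    volume {y ∈ ball c R | φ y < t} < volume {y ∈ ball c R | φ y < t'} := by
  obtain ⟨y₁, hy₁, hy₁t⟩ := nonempty_of_measure_ne_zero h0
  obtain ⟨y₂, hy₂, hy₂t⟩ : ∃ y ∈ ball c R, t' ≤ φ y := by
    by_contra! hcon
    exact h1.not_ge (measure_mono fun y hy => ⟨hy, hcon y hy⟩)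
  obtain ⟨z, hz, hzt⟩ : (t + t') / 2 ∈ φ '' ball c R :=
    (convex_ball c R).isPreconnected.intermediate_value hy₁ hy₂ hφ ⟨by linarith, by linarith⟩
  have hU : IsOpen (ball c R ∩ φ ⁻¹' Ioo t t') := hφ.isOpen_inter_preimage isOpen_ball isOpen_Ioo
  have hpos : 0 < volume (ball c R ∩ φ ⁻¹' Ioo t t') :=
    hU.measure_pos _ ⟨z, hz, by rw [mem_preimage, hzt]; constructor <;> linarith⟩
  have hdisj : Disjoint {y ∈ ball c R | φ y < t} (ball c R ∩ φ ⁻¹' Ioo t t') :=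
    disjoint_left.2 fun y hy hy' => lt_asymm hy.2 hy'.2.1
  have hfin : volume {y ∈ ball c R | φ y < t} ≠ ⊤ :=
    ((measure_mono fun y hy => hy.1).trans_lt measure_ball_lt_top).ne
  calc volume {y ∈ ball c R | φ y < t}
      < volume {y ∈ ball c R | φ y < t} + volume (ball c R ∩ φ ⁻¹' Ioo t t') :=
        ENNReal.lt_add_right hfin hpos.ne'
    _ = volume ({y ∈ ball c R | φ y < t} ∪ (ball c R ∩ φ ⁻¹' Ioo t t')) :=
        (measure_union hdisj hU.measurableSet).symm
    _ ≤ volume {y ∈ ball c R | φ y < t'} := by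
        refine measure_mono (union_subset (fun y hy => ⟨hy.1, hy.2.trans htt'⟩) ?_)
        exact fun y hy => ⟨hy.1, hy.2.2⟩

/-- The jumps of the generalized inverse that defines the symmetrization come from the flat parts
of the distribution function, which `volume_sublevel_lt` excludes. -/
theorem continuousOn_schwarz (hn : 1 ≤ n) (hφ : ContinuousOn φ (ball c R))
    (hm : ∀ y ∈ ball c R, |φ y| ≤ m) :
    ContinuousOn (schwarz (ball c R) φ) (ball 0 R) := by
  intro x hx
  refine ContinuousAt.continuousWithinAt ?_
  have hxR : ‖x‖ < R := by simpa using hx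
  have hev : ∀ᶠ y in nhds x, ‖y‖ < R := continuous_norm.tendsto x |>.eventually_lt_const hxR
  have hvol := (continuous_volume_ball_norm hn).tendsto x
  refine tendsto_order.2 ⟨fun t ht => ?_, fun t ht => ?_⟩
  · obtain ⟨t', htt', ht'⟩ := exists_between ht
    obtain ⟨t₁, htt₁, ht₁⟩ := exists_between htt'
    have h1 : volume {y ∈ ball c R | φ y < t'} ≤ volume (ball (0 : E n) ‖x‖) := by
      by_contra! hcon
      exact ht'.not_ge (csInf_le (schwarz_bddBelow hm x) hcon)
    have h2 : ∀ᶠ y in nhds x, volume {z ∈ ball c R | φ z < t₁} ≤ volume (ball (0 : E n) ‖y‖) := by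
      by_cases h0 : volume {y ∈ ball c R | φ y < t₁} = 0
      · exact Filter.Eventually.of_forall fun y => h0.trans_le bot_le
      · have h3 := volume_sublevel_lt hφ ht₁ h0
          (h1.trans_lt (volume_ball_lt_volume_ball hn c (norm_nonneg x) hxR))
        exact (hvol.eventually_const_lt (h3.trans_le h1)).mono fun y hy => hy.le
    filter_upwards [hev, h2] with y hyR hy
    refine htt₁.trans_le (le_csInf (schwarz_nonempty hn hm hyR) fun s hs => ?_)
    by_contra! hst
    exact absurd (hy.trans_lt hs) (not_lt.2 (measure_mono fun z hz => ⟨hz.1, hz.2.trans hst⟩))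
  · obtain ⟨s, hs, hst⟩ := exists_lt_of_csInf_lt (schwarz_nonempty hn hm hxR) ht
    filter_upwards [hvol.eventually_lt_const hs] with y hy
    exact (csInf_le (schwarz_bddBelow hm y) hy).trans_lt hst

end Schwarz

/-! ### The energy through subgradients -/

section Energy

variable {n : ℕ} {Ω : Set (E n)} {φ : E n → ℝ}

theorem mem_gradImage_iff {A : Set (E n)} {p : E n} :
    p ∈ gradImage Ω φ A ↔ ∃ x ∈ A ∩ Ω, p ∈ subdifferential Ω φ x := by
  simp only [gradImage, mem_iUnion, exists_prop]

/-- The layer cake formula for the energy. -/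
theorem energy_eq_lintegral_volume_gradImage (hΩ : IsOpen Ω) (hb : Bornology.IsBounded Ω)
    (hφ : ContinuousOn φ Ω) (h0 : ∀ x ∈ Ω, φ x ≤ 0) :
    energy Ω φ = ∫⁻ t in Ioi (0 : ℝ), volume (gradImage Ω φ {x | t < -φ x}) := by
  rw [energy, lintegral_eq_lintegral_meas_lt (f := fun x => -φ x) _
    ((ae_restrict_iff' hΩ.measurableSet).2 (Filter.Eventually.of_forall fun x hx => by
      simpa using h0 x hx)) (hφ.neg.aemeasurable hΩ.measurableSet)]
  refine lintegral_congr fun t => ?_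
  have hopen : IsOpen (Ω ∩ (fun x => -φ x) ⁻¹' Ioi t) := hφ.neg.isOpen_inter_preimage hΩ isOpen_Ioi
  have e : {x | t < -φ x} ∩ Ω = Ω ∩ (fun x => -φ x) ⁻¹' Ioi t := inter_comm _ _
  rw [Measure.restrict_apply' hΩ.measurableSet, e, mongeAmpere_apply hΩ hb hφ hopen.measurableSet]
  congr 1
  ext p
  simp only [mem_gradImage_iff, ← e, inter_assoc, inter_self]

theorem lintegral_ofReal_eq_lintegral_meas_lt {H : E n → ℝ} (hH : Measurable H) :
    ∫⁻ p, ENNReal.ofReal (H p) = ∫⁻ t in Ioi (0 : ℝ), volume {p | t < H p} := by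
  have h1 := lintegral_eq_lintegral_meas_lt (volume : Measure (E n)) (f := fun p => max (H p) 0)
    (Filter.Eventually.of_forall fun p => le_max_right _ _)
    (hH.max measurable_const).aemeasurable
  have e : ∀ p, ENNReal.ofReal (max (H p) 0) = ENNReal.ofReal (H p) := fun p => by
    rw [ENNReal.ofReal_max]; simp
  simp only [e] at h1
  rw [h1]
  refine setLIntegral_congr_fun measurableSet_Ioi fun t ht => ?_
  have ht0 : (0 : ℝ) < t := ht
  simp [ht0.le.not_gt]

theorem energy_le_lintegral (hΩ : IsOpen Ω) (hb : Bornology.IsBounded Ω)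
    (hφ : ContinuousOn φ Ω) (h0 : ∀ x ∈ Ω, φ x ≤ 0) {H : E n → ℝ} (hH : Measurable H)
    (hle : ∀ x ∈ Ω, ∀ p ∈ subdifferential Ω φ x, -φ x ≤ H p) :
    energy Ω φ ≤ ∫⁻ p, ENNReal.ofReal (H p) := by
  rw [energy_eq_lintegral_volume_gradImage hΩ hb hφ h0, lintegral_ofReal_eq_lintegral_meas_lt hH]
  refine lintegral_mono fun t => measure_mono fun p hp => ?_
  obtain ⟨x, ⟨hxt, hx⟩, hp⟩ := mem_gradImage_iff.1 hp
  exact lt_of_lt_of_le hxt (hle x hx p hp)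

theorem lintegral_le_energy (hΩ : IsOpen Ω) (hb : Bornology.IsBounded Ω)
    (hφ : ContinuousOn φ Ω) (h0 : ∀ x ∈ Ω, φ x ≤ 0) {H : E n → ℝ} (hH : Measurable H)
    (hle : ∀ p, 0 < H p → ∃ x ∈ Ω, p ∈ subdifferential Ω φ x ∧ H p ≤ -φ x) :
    ∫⁻ p, ENNReal.ofReal (H p) ≤ energy Ω φ := by
  rw [energy_eq_lintegral_volume_gradImage hΩ hb hφ h0, lintegral_ofReal_eq_lintegral_meas_lt hH]
  refine setLIntegral_mono' measurableSet_Ioi fun t ht => measure_mono fun p hp => ?_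
  obtain ⟨x, hx, hpx, hHx⟩ := hle p (lt_trans ht hp)
  exact mem_gradImage_iff.2 ⟨x, ⟨lt_of_lt_of_le hp hHx, hx⟩, hpx⟩

end Energy

/-! ### The Legendre transform -/

section Legendre

variable {n : ℕ} {c : E n} {R m : ℝ} {S : Set (E n)} {φ : E n → ℝ}

/-- The excess of the Legendre transform of `φ` on `S`, with the origin of `ℝⁿ` moved to `c`, over
the support function `R ‖p‖` of the ball of radius `R`. -/
noncomputable def legendreExcess (c : E n) (R : ℝ) (S : Set (E n)) (φ : E n → ℝ) (p : E n) : ℝ :=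
  (⨆ y : S, (inner ℝ p ((y : E n) - c) - φ y)) - R * ‖p‖

theorem bddAbove_legendre (hS : S ⊆ closedBall c R) (hm : ∀ y ∈ S, |φ y| ≤ m) (p : E n) :
    BddAbove (range fun y : S => inner ℝ p ((y : E n) - c) - φ y) := by
  refine ⟨‖p‖ * R + m, ?_⟩
  rintro _ ⟨⟨y, hy⟩, rfl⟩
  have h1 : inner ℝ p (y - c) ≤ ‖p‖ * R := (real_inner_le_norm _ _).trans
    (mul_le_mul_of_nonneg_left (mem_closedBall_iff_norm.1 (hS hy)) (norm_nonneg p))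
  have h2 := neg_abs_le (φ y)
  have h3 := hm y hy
  simp only
  linarith

theorem le_legendreExcess (hS : S ⊆ closedBall c R) (hm : ∀ y ∈ S, |φ y| ≤ m) {y : E n}
    (hy : y ∈ S) (p : E n) :
    inner ℝ p (y - c) - φ y ≤ legendreExcess c R S φ p + R * ‖p‖ := by
  rw [legendreExcess, sub_add_cancel]
  exact le_ciSup (bddAbove_legendre hS hm p) ⟨y, hy⟩

theorem legendreExcess_le (hne : S.Nonempty) {p : E n} {a : ℝ}
    (h : ∀ y ∈ S, inner ℝ p (y - c) - φ y ≤ a + R * ‖p‖) : legendreExcess c R S φ p ≤ a := by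
  have : Nonempty S := hne.to_subtype
  rw [legendreExcess, sub_le_iff_le_add]
  exact ciSup_le fun y => h y y.2

theorem continuous_legendreExcess (hR : 0 ≤ R) (hne : S.Nonempty) (hS : S ⊆ closedBall c R)
    (hm : ∀ y ∈ S, |φ y| ≤ m) : Continuous (legendreExcess c R S φ) := by
  have : Nonempty S := hne.to_subtype
  have hlip : LipschitzWith ⟨R, hR⟩
      fun p => ⨆ y : S, (inner ℝ p ((y : E n) - c) - φ y) := by
    refine LipschitzWith.of_le_add_mul _ fun p q => ciSup_le fun y => ?_
    have h1 := le_ciSup (bddAbove_legendre hS hm q) y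
    have h2 : inner ℝ (p - q) ((y : E n) - c) ≤ ‖p - q‖ * R := (real_inner_le_norm _ _).trans
      (mul_le_mul_of_nonneg_left (mem_closedBall_iff_norm.1 (hS y.2)) (norm_nonneg _))
    rw [inner_sub_left] at h2
    rw [dist_eq_norm]
    change _ ≤ _ + R * ‖p - q‖
    linarith
  exact hlip.continuous.sub (by fun_prop)

theorem legendreExcess_nonneg (hR : 0 < R) (hball : ball c R ⊆ S) (hS : S ⊆ closedBall c R)
    (hm : ∀ y ∈ S, |φ y| ≤ m) (h0 : ∀ y ∈ S, φ y ≤ 0) (p : E n) :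
    0 ≤ legendreExcess c R S φ p := by
  by_cases hp : p = 0
  · have hc : c ∈ S := hball (mem_ball_self hR)
    have h := le_legendreExcess hS hm hc p
    simp only [hp, inner_zero_left, norm_zero, mul_zero, add_zero] at h ⊢
    linarith [h0 c hc]
  have hp' : ‖p‖ ≠ 0 := norm_ne_zero_iff.2 hp
  -- the points `c + s R p / ‖p‖` with `s < 1` approach the maximum of `p` on the ball
  have h := le_on_closure (s := Ico (0 : ℝ) 1) (f := fun s => s * (R * ‖p‖))
    (g := fun _ => legendreExcess c R S φ p + R * ‖p‖) (fun s hs => by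
      have hy : c + (s * R / ‖p‖) • p ∈ S := by
        refine hball ?_
        rw [mem_ball_iff_norm, add_sub_cancel_left, norm_smul, Real.norm_of_nonneg
          (div_nonneg (mul_nonneg hs.1 hR.le) (norm_nonneg p)), div_mul_cancel₀ _ hp']
        exact mul_lt_of_lt_one_left hR hs.2
      have h1 := le_legendreExcess hS hm hy p
      rw [add_sub_cancel_left, real_inner_smul_right, real_inner_self_eq_norm_sq] at h1
      have e : s * R / ‖p‖ * ‖p‖ ^ 2 = s * (R * ‖p‖) := by field_simp
      have h2 := h0 _ hy
      linarith) (by fun_prop) (by fun_prop) (x := 1) (by rw [closure_Ico zero_ne_one]; simp)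
  linarith

/-- The Legendre transform grows along the ray through `p` at least as fast as prescribed by any
point `x` where the supremum at `p` is attained. -/
theorem legendreExcess_le_scaled (hS : S ⊆ closedBall c R) (hm : ∀ y ∈ S, |φ y| ≤ m) {x p : E n}
    (hx : x ∈ S) (hmax : ∀ y ∈ S, inner ℝ p (y - c) - φ y ≤ inner ℝ p (x - c) - φ x) {μ : ℝ}
    (hμ : 0 < μ) :
    legendreExcess c R S φ p ≤ μ * legendreExcess c R S φ (μ⁻¹ • p) + (1 - μ) * -φ x := by
  refine legendreExcess_le ⟨x, hx⟩ fun y hy => (hmax y hy).trans ?_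
  have h := mul_le_mul_of_nonneg_left (le_legendreExcess hS hm hx (μ⁻¹ • p)) hμ.le
  rw [real_inner_smul_left, norm_smul, Real.norm_of_nonneg (inv_nonneg.2 hμ.le)] at h
  have e1 : μ * (μ⁻¹ * inner ℝ p (x - c) - φ x) = inner ℝ p (x - c) - μ * φ x := by
    field_simp
  have e2 : μ * (legendreExcess c R S φ (μ⁻¹ • p) + R * (μ⁻¹ * ‖p‖)) =
      μ * legendreExcess c R S φ (μ⁻¹ • p) + R * ‖p‖ := by
    field_simp
  rw [e1, e2] at h
  linarith

theorem legendreExcess_le_scaled_of_one_le (hS : S ⊆ closedBall c R) (hne : S.Nonempty)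
    (hm : ∀ y ∈ S, |φ y| ≤ m) (h0 : ∀ y ∈ S, φ y ≤ 0) (p : E n) {μ : ℝ} (hμ : 1 ≤ μ) :
    legendreExcess c R S φ p ≤ μ * legendreExcess c R S φ (μ⁻¹ • p) := by
  have hμ0 : 0 < μ := one_pos.trans_le hμ
  refine legendreExcess_le hne fun y hy => ?_
  have h := mul_le_mul_of_nonneg_left (le_legendreExcess hS hm hy (μ⁻¹ • p)) hμ0.le
  rw [real_inner_smul_left, norm_smul, Real.norm_of_nonneg (inv_nonneg.2 hμ0.le)] at h
  have e1 : μ * (μ⁻¹ * inner ℝ p (y - c) - φ y) = inner ℝ p (y - c) - μ * φ y := by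
    field_simp
  have e2 : μ * (legendreExcess c R S φ (μ⁻¹ • p) + R * (μ⁻¹ * ‖p‖)) =
      μ * legendreExcess c R S φ (μ⁻¹ • p) + R * ‖p‖ := by
    field_simp
  rw [e1, e2] at h
  nlinarith [h0 y hy]

theorem lintegral_scaled (F : E n → ℝ) (hF : Measurable F) {μ : ℝ} (hμ : 0 < μ) :
    ∫⁻ p, ENNReal.ofReal (μ * F (μ⁻¹ • p)) =
      ENNReal.ofReal (μ ^ (n + 1)) * ∫⁻ p, ENNReal.ofReal (F p) := by
  have h1 : ∫⁻ p, ENNReal.ofReal (F (μ⁻¹ • p)) =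
      ∫⁻ p, ENNReal.ofReal (F p) ∂(Measure.map (μ⁻¹ • ·) (volume : Measure (E n))) :=
    (lintegral_map hF.ennreal_ofReal (measurable_const_smul _)).symm
  rw [Measure.map_addHaar_smul _ (inv_ne_zero hμ.ne'), lintegral_smul_measure] at h1
  simp_rw [ENNReal.ofReal_mul hμ.le]
  have hFμ : Measurable fun p => F (μ⁻¹ • p) := hF.comp (measurable_const_smul _)
  rw [lintegral_const_mul _ hFμ.ennreal_ofReal, h1, smul_eq_mul,
    ← mul_assoc, ← ENNReal.ofReal_mul hμ.le, finrank_euclideanSpace_fin, inv_pow, inv_inv,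
    abs_of_pos (by positivity), pow_succ']

/-! ### The energy through the Legendre transform -/

theorem tendsto_ofReal_geom_sum_mul {I : ENNReal} (hI : I ≠ ⊤) (s : Set ℝ) :
    Filter.Tendsto (fun μ : ℝ => ENNReal.ofReal (∑ k ∈ Finset.range (n + 1), μ ^ k) * I)
      (nhdsWithin 1 s) (nhds ((n + 1) * I)) := by
  have hc : Continuous fun μ : ℝ => ENNReal.ofReal (∑ k ∈ Finset.range (n + 1), μ ^ k) * I :=
    (ENNReal.continuous_mul_const hI).comp (ENNReal.continuous_ofReal.comp (by fun_prop))
  have h := (hc.tendsto 1).mono_left (nhdsWithin_le_nhds (s := s))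
  have e : ENNReal.ofReal ((n : ℝ) + 1) = (n : ENNReal) + 1 := by
    rw [ENNReal.ofReal_add (Nat.cast_nonneg n) zero_le_one]; simp
  simpa [e] using h

theorem mem_subdifferential_iff_legendre {x p : E n} :
    p ∈ subdifferential S φ x ↔
      ∀ y ∈ S, inner ℝ p (y - c) - φ y ≤ inner ℝ p (x - c) - φ x := by
  refine forall₂_congr fun y hy => ?_
  have e : y - x = (y - c) - (x - c) := by abel
  rw [e, inner_sub_right]
  constructor <;> intro h <;> linarith

/-- The energy of a nonpositive function on a ball is at most `n + 1` times the integral of its Legendre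
excess `F`. By `legendreExcess_le_scaled`, `(μ - 1) (-φ x) ≤ μ F (p / μ) - F p` when `p` is a
subgradient at `x` and `μ > 1`; integrate over `p` and let `μ` tend to `1`. -/
theorem energy_le_lintegral_legendreExcess (hR : 0 < R) (hφ : ContinuousOn φ (ball c R))
    (hm : ∀ y ∈ ball c R, |φ y| ≤ m) (h0 : ∀ y ∈ ball c R, φ y ≤ 0)
    (hfin : ∫⁻ p, ENNReal.ofReal (legendreExcess c R (ball c R) φ p) ≠ ⊤) :
    energy (ball c R) φ ≤
      (n + 1) * ∫⁻ p, ENNReal.ofReal (legendreExcess c R (ball c R) φ p) := by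
  set F := legendreExcess c R (ball c R) φ
  have hne : (ball c R).Nonempty := ⟨c, mem_ball_self hR⟩
  have hFc : Continuous F := continuous_legendreExcess hR.le hne ball_subset_closedBall hm
  have hF0 : ∀ p, 0 ≤ F p := legendreExcess_nonneg hR subset_rfl ball_subset_closedBall hm h0
  set I := ∫⁻ p, ENNReal.ofReal (F p)
  have key : ∀ μ : ℝ, 1 < μ →
      energy (ball c R) φ ≤ ENNReal.ofReal (∑ k ∈ Finset.range (n + 1), μ ^ k) * I := by
    intro μ hμ
    have hμ0 : 0 < μ := one_pos.trans hμ
    have hμ1 : 0 < μ - 1 := sub_pos.2 hμ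
    have hH : Measurable fun p => (μ * F (μ⁻¹ • p) - F p) / (μ - 1) :=
      (by fun_prop : Continuous fun p => (μ * F (μ⁻¹ • p) - F p) / (μ - 1)).measurable
    have h1 : energy (ball c R) φ ≤
        ∫⁻ p, ENNReal.ofReal ((μ * F (μ⁻¹ • p) - F p) / (μ - 1)) := by
      refine energy_le_lintegral isOpen_ball isBounded_ball hφ h0
        hH fun x hx p hp => ?_
      rw [le_div_iff₀ hμ1]
      have := legendreExcess_le_scaled ball_subset_closedBall hm hx
        ((mem_subdifferential_iff_legendre (c := c)).1 hp) hμ0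
      linarith
    have h2 : ENNReal.ofReal (μ - 1) *
        (∫⁻ p, ENNReal.ofReal ((μ * F (μ⁻¹ • p) - F p) / (μ - 1))) + I =
        ENNReal.ofReal (μ ^ (n + 1)) * I := by
      rw [← lintegral_scaled F hFc.measurable hμ0, ← lintegral_const_mul _
        hH.ennreal_ofReal,
        ← lintegral_add_right _ hFc.measurable.ennreal_ofReal]
      refine lintegral_congr fun p => ?_
      have h3 := legendreExcess_le_scaled_of_one_le ball_subset_closedBall hne hm h0 p hμ.le
      rw [← ENNReal.ofReal_mul hμ1.le, ← ENNReal.ofReal_add (mul_nonneg hμ1.le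
        (div_nonneg (sub_nonneg.2 h3) hμ1.le)) (hF0 p), mul_div_cancel₀ _ hμ1.ne', sub_add_cancel]
    have h4 : ENNReal.ofReal (μ ^ (n + 1)) * I =
        ENNReal.ofReal (μ - 1) * (ENNReal.ofReal (∑ k ∈ Finset.range (n + 1), μ ^ k) * I) + I := by
      have hs : 0 ≤ ∑ k ∈ Finset.range (n + 1), μ ^ k :=
        Finset.sum_nonneg fun k _ => pow_nonneg hμ0.le k
      have e : μ ^ (n + 1) = (μ - 1) * (∑ k ∈ Finset.range (n + 1), μ ^ k) + 1 := by
        rw [mul_geom_sum]; ring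
      rw [e, ENNReal.ofReal_add (mul_nonneg hμ1.le hs) zero_le_one, ENNReal.ofReal_mul hμ1.le,
        add_mul, ENNReal.ofReal_one, one_mul, mul_assoc]
    have h5 := (ENNReal.add_left_inj hfin).1 (h2.trans h4)
    have h6 := (ENNReal.mul_right_inj (by simpa using hμ) ENNReal.ofReal_ne_top).1 h5
    exact h1.trans h6.le
  exact ge_of_tendsto (tendsto_ofReal_geom_sum_mul hfin (Ioi 1))
    (eventually_nhdsWithin_of_forall key)

/-- The energy of a nonpositive function on a ball that vanishes on the boundary is at least
`n + 1` times the integral of its Legendre excess `F`. The supremum at `p` is attained in the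
closed ball; if `x` is the maximum point, then `F p - μ F (p / μ) ≤ (1 - μ) (-φ x)` for
`0 < μ < 1`, and where the left side is positive, `x` is interior and `p` is a subgradient at `x`.
Integrate and let `μ` tend to `1`. -/
theorem lintegral_legendreExcess_le_energy (hR : 0 < R) (hφ : ContinuousOn φ (closedBall c R))
    (hm : ∀ y ∈ closedBall c R, |φ y| ≤ m) (h0 : ∀ y ∈ closedBall c R, φ y ≤ 0)
    (hbdry : ∀ y ∈ sphere c R, φ y = 0) :
    (n + 1) * ∫⁻ p, ENNReal.ofReal (legendreExcess c R (closedBall c R) φ p) ≤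
      energy (ball c R) φ := by
  set F := legendreExcess c R (closedBall c R) φ
  have hne : (closedBall c R).Nonempty := ⟨c, mem_closedBall_self hR.le⟩
  have hFc : Continuous F := continuous_legendreExcess hR.le hne subset_rfl hm
  set I := ∫⁻ p, ENNReal.ofReal (F p)
  have hmax : ∀ p : E n, ∃ x ∈ closedBall c R, ∀ y ∈ closedBall c R,
      inner ℝ p (y - c) - φ y ≤ inner ℝ p (x - c) - φ x := fun p =>
    (isCompact_closedBall c R).exists_isMaxOn hne
      ((by fun_prop : Continuous fun y : E n => (inner ℝ p (y - c) : ℝ)).continuousOn.sub hφ)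
  have hint : ∀ H : E n → ℝ, Measurable H →
      (∀ p, ∀ x ∈ closedBall c R, (∀ y ∈ closedBall c R,
        inner ℝ p (y - c) - φ y ≤ inner ℝ p (x - c) - φ x) → H p ≤ -φ x) →
      ∫⁻ p, ENNReal.ofReal (H p) ≤ energy (ball c R) φ := by
    intro H hH hle
    refine lintegral_le_energy isOpen_ball isBounded_ball (hφ.mono ball_subset_closedBall)
      (fun x hx => h0 x (ball_subset_closedBall hx)) hH fun p hp => ?_
    obtain ⟨x, hx, hxmax⟩ := hmax p
    have hHx := hle p x hx hxmax
    have hxb : x ∈ ball c R := by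
      by_contra hcon
      have hxs : x ∈ sphere c R := by
        rw [mem_sphere]
        exact le_antisymm (mem_closedBall.1 hx) (not_lt.1 hcon)
      have := hbdry x hxs
      linarith
    exact ⟨x, hxb, (mem_subdifferential_iff_legendre (c := c)).2
      fun y hy => hxmax y (ball_subset_closedBall hy), hHx⟩
  by_cases hE : energy (ball c R) φ = ⊤
  · rw [hE]; exact le_top
  have hIE : I ≤ energy (ball c R) φ := by
    refine hint F hFc.measurable fun p x hx hxmax => legendreExcess_le hne fun y hy => ?_
    have h1 := hxmax y hy
    have h2 : inner ℝ p (x - c) ≤ ‖p‖ * R := (real_inner_le_norm _ _).trans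
      (mul_le_mul_of_nonneg_left (mem_closedBall_iff_norm.1 hx) (norm_nonneg p))
    linarith
  have hfin : I ≠ ⊤ := (hIE.trans_lt (lt_top_iff_ne_top.2 hE)).ne
  have key : ∀ μ ∈ Ioo (0 : ℝ) 1,
      ENNReal.ofReal (∑ k ∈ Finset.range (n + 1), μ ^ k) * I ≤ energy (ball c R) φ := by
    rintro μ ⟨hμ0, hμ⟩
    have hμ1 : 0 < 1 - μ := sub_pos.2 hμ
    have hsc : Continuous fun p => μ * F (μ⁻¹ • p) := by fun_prop
    have hH : Measurable fun p => (F p - μ * F (μ⁻¹ • p)) / (1 - μ) :=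
      (by fun_prop : Continuous fun p => (F p - μ * F (μ⁻¹ • p)) / (1 - μ)).measurable
    have h1 : ∫⁻ p, ENNReal.ofReal ((F p - μ * F (μ⁻¹ • p)) / (1 - μ)) ≤
        energy (ball c R) φ := by
      refine hint _ hH fun p x hx hxmax => ?_
      rw [div_le_iff₀ hμ1]
      have := legendreExcess_le_scaled subset_rfl hm hx hxmax hμ0
      linarith
    have h2 : I ≤ ENNReal.ofReal (μ ^ (n + 1)) * I + ENNReal.ofReal (1 - μ) *
        (∫⁻ p, ENNReal.ofReal ((F p - μ * F (μ⁻¹ • p)) / (1 - μ))) := by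
      rw [← lintegral_scaled F hFc.measurable hμ0, ← lintegral_const_mul _
        hH.ennreal_ofReal,
        ← lintegral_add_left hsc.measurable.ennreal_ofReal]
      refine lintegral_mono fun p => ?_
      rw [← ENNReal.ofReal_mul hμ1.le, mul_div_cancel₀ _ hμ1.ne']
      refine le_trans (ENNReal.ofReal_le_ofReal ?_) ENNReal.ofReal_add_le
      linarith
    have h4 : I = ENNReal.ofReal (μ ^ (n + 1)) * I + ENNReal.ofReal (1 - μ) *
        (ENNReal.ofReal (∑ k ∈ Finset.range (n + 1), μ ^ k) * I) := by
      have hs : 0 ≤ ∑ k ∈ Finset.range (n + 1), μ ^ k :=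
        Finset.sum_nonneg fun k _ => pow_nonneg hμ0.le k
      have e : μ ^ (n + 1) + (1 - μ) * (∑ k ∈ Finset.range (n + 1), μ ^ k) = 1 := by
        rw [mul_neg_geom_sum]; ring
      rw [← mul_assoc, ← ENNReal.ofReal_mul hμ1.le, ← add_mul, ← ENNReal.ofReal_add
        (by positivity) (mul_nonneg hμ1.le hs), e, ENNReal.ofReal_one, one_mul]
    have h5 := h4.symm.le.trans h2
    have h6 := (ENNReal.add_le_add_iff_left
      (ENNReal.mul_ne_top ENNReal.ofReal_ne_top hfin)).1 h5
    have h7 := (ENNReal.mul_le_mul_iff_right (by simpa using hμ) ENNReal.ofReal_ne_top).1 h6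
    exact h7.trans h1
  have : (nhdsWithin (1 : ℝ) (Ioo 0 1)).NeBot := right_nhdsWithin_Ioo_neBot one_pos
  exact le_of_tendsto (tendsto_ofReal_geom_sum_mul hfin (Ioo 0 1))
    (eventually_nhdsWithin_of_forall key)

/-- The Legendre excess of the symmetrization is at most the rotation average of the Legendre
excess. A sublevel set of `φ` is larger than the ball it is symmetrized to, so by Urysohn's
inequality its mean width is larger too. -/
theorem legendreExcess_schwarz_le (hn : 1 ≤ n) (hR : 0 < R)
    (hm : ∀ y ∈ closedBall c R, |φ y| ≤ m) (p : E n) :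
    legendreExcess 0 R (ball 0 R) (schwarz (ball c R) φ) p ≤
      rotationAverage (legendreExcess c R (closedBall c R) φ) p := by
  set F := legendreExcess c R (closedBall c R) φ
  have hFc : Continuous F :=
    continuous_legendreExcess hR.le ⟨c, mem_closedBall_self hR.le⟩ subset_rfl hm
  have hm' : ∀ y ∈ ball c R, |φ y| ≤ m := fun y hy => hm y (ball_subset_closedBall hy)
  refine legendreExcess_le ⟨0, mem_ball_self hR⟩ fun x hx => ?_
  rw [sub_zero, sub_le_iff_le_add, ← sub_le_iff_le_add']
  refine le_of_forall_gt_imp_ge_of_dense fun t ht => ?_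
  have hvol := volume_ball_lt_of_schwarz_lt hn hm' (by simpa using hx) ht
  by_cases hp : p = 0
  · obtain ⟨y, hy, hyt⟩ := nonempty_of_measure_ne_zero (pos_of_gt hvol).ne'
    have h1 := le_legendreExcess subset_rfl hm (ball_subset_closedBall hy) (0 : E n)
    rw [hp, rotationAverage_zero]
    simp only [inner_zero_left, norm_zero, mul_zero, add_zero] at h1 ⊢
    linarith
  have hK : volume ((fun z => z + c) ⁻¹' {y ∈ ball c R | φ y < t}) =
      volume {y ∈ ball c R | φ y < t} := measure_preimage_add_right _ _ _
  rw [← hK] at hvol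
  have h1 := mul_le_rotationAverage (norm_pos_iff.2 hp) hvol
    (g := fun q => F q + (R * ‖p‖ + t)) (by fun_prop) (fun z hz q hq => by
      have h2 := le_legendreExcess subset_rfl hm (ball_subset_closedBall hz.1) q
      have h3 : φ (z + c) < t := hz.2
      rw [add_sub_cancel_right, hq, real_inner_comm] at h2
      linarith) rfl
  rw [rotationAverage_add_const hFc] at h1
  have h2 := real_inner_le_norm p x
  linarith [mul_comm ‖p‖ ‖x‖]

end Legendre

end SchwarzMA

open SchwarzMA in
theorem theorem4p2 (n : ℕ) (hn : 1 ≤ n) (c : EuclideanSpace ℝ (Fin n)) (R : ℝ) (hR : 0 < R)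
    (φ : EuclideanSpace ℝ (Fin n) → ℝ)
    (hconv : ConvexOn ℝ (Metric.ball c R) φ)
    (hcont : ContinuousOn φ (Metric.closedBall c R))
    (hbdry : ∀ x ∈ Metric.sphere c R, φ x = 0) :
    SchwarzMA.energy (Metric.ball 0 R) (SchwarzMA.schwarz (Metric.ball c R) φ) ≤
      SchwarzMA.energy (Metric.ball c R) φ := by
  have := nontrivial_of_one_le hn
  have h0 := ConvexOn.nonpos_of_sphere hR.le (hconv.closedBall_of_ball hcont) hbdry
  obtain ⟨m, hm⟩ := (isCompact_closedBall c R).exists_bound_of_continuousOn hcont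
  have hm' : ∀ y ∈ ball c R, |φ y| ≤ m := fun y hy => hm y (ball_subset_closedBall hy)
  have h0' : ∀ y ∈ ball c R, φ y ≤ 0 := fun y hy => h0 y (ball_subset_closedBall hy)
  have hs0 : ∀ x ∈ ball 0 R, schwarz (ball c R) φ x ≤ 0 := fun x hx =>
    schwarz_nonpos hn hm' h0' (by simpa using hx)
  have hsm : ∀ x ∈ ball 0 R, |schwarz (ball c R) φ x| ≤ m := fun x hx => by
    rw [abs_of_nonpos (hs0 x hx)]
    linarith [neg_le_schwarz hn hm' (by simpa using hx)]
  have hI : ∫⁻ p, ENNReal.ofReal (legendreExcess 0 R (ball 0 R) (schwarz (ball c R) φ) p) ≤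
      ∫⁻ p, ENNReal.ofReal (legendreExcess c R (closedBall c R) φ p) := by
    rw [lintegral_eq_lintegral_rotationAverage
      (continuous_legendreExcess hR.le ⟨c, mem_closedBall_self hR.le⟩ subset_rfl hm)
      (legendreExcess_nonneg hR ball_subset_closedBall subset_rfl hm h0)]
    exact lintegral_mono fun p => ENNReal.ofReal_le_ofReal (legendreExcess_schwarz_le hn hR hm p)
  have hE := lintegral_legendreExcess_le_energy hR hcont hm h0 hbdry
  by_cases hfin : energy (ball c R) φ = ⊤
  · rw [hfin]; exact le_top
  have hfin' : ∫⁻ p, ENNReal.ofReal (legendreExcess c R (closedBall c R) φ p) ≠ ⊤ := fun h => by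
    rw [h, ENNReal.mul_top (by simp)] at hE
    exact hfin (top_le_iff.1 hE)
  calc energy (ball 0 R) (schwarz (ball c R) φ)
      ≤ (n + 1) * ∫⁻ p, ENNReal.ofReal
          (legendreExcess 0 R (ball 0 R) (schwarz (ball c R) φ) p) :=
        energy_le_lintegral_legendreExcess hR
          (continuousOn_schwarz hn (hcont.mono ball_subset_closedBall) hm') hsm hs0
          (hI.trans_lt (lt_top_iff_ne_top.2 hfin')).ne
    _ ≤ (n + 1) * ∫⁻ p, ENNReal.ofReal (legendreExcess c R (closedBall c R) φ p) := by gcongr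
    _ ≤ energy (ball c R) φ := hE
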